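/- Let $\mathcal X$ be a measurable space, let $c\ge 0$ and $n\ge 1$ be integers, and let $D$ be a probability distribution on $\mathcal X\times\{-1,+1\}^c$. Let $\kappa:\mathcal X\times\mathcal X\to\mathbb R$ be a measurable positive definite symmetric kernel with reproducing kernel Hilbert space $\mathbb H$, let $\phi:\mathcal X\to\mathbb H$ be a feature mapping associated with $\kappa$, i.e. $\langle\phi(x),\phi(x')\rangle_{\mathbb H}=\kappa(x,x')$ for all $x,x'$, and suppose that $\kappa(x,x)\le r^2$ for all $x\in\mathcal X$, for some $r>0$. For $\Lambda\in\mathbb R$ let $$\mathcal F=\Big\{x\mapsto W^\top\phi(x)=\big(\langle w_j,\phi(x)\rangle_{\mathbb H}\big)_{j=1}^c\ :\ W=(w_1,\dots,w_c)^\top\in\mathbb H^c,\ \|W\|_{\mathbb H,2}=\Big(\sum_{j=1}^c\|w_j\|_{\mathbb H}^2\Big)^{1/2}\le\Lambda\Big\}.$$ Let $L:\mathbb R^c\times\{-1,+1\}^c\to[0,\infty)$ be bounded by $M$ and $\mu$-Lipschitz in its first argument with respect to the Euclidean norm on $\mathbb R^c$. For $f\in\mathcal F$ and a sample $S=((x_i,y_i))_{i=1}^n$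 put $$R(f)=\mathbb E_{(x,y)\sim D}\,[L(f(x),y)],\qquad \hat R_S(f)=\frac1n\sum_{i=1}^n L(f(x_i),y_i).$$ Then $(x,y)\mapsto L(f(x),y)$ is $D$-integrable for every $f\in\mathcal F$, and for every $\delta>0$, with probability at least $1-\delta$ over the draw of an i.i.d. sample $S\sim D^n$ (that is, on a measurable event of probability at least $1-\delta$), the following holds simultaneously for all $f\in\mathcal F$: $$R(f)\ \le\ \hat R_S(f)+2\sqrt2\,\mu\sqrt{\frac{c\Lambda^2r^2}{n}}+3M\sqrt{\frac{\log(2/\delta)}{2n}},$$ where for $\delta>2$ the last square root is read as $0$. -/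

import Mathlib

open MeasureTheory
open scoped NNReal

noncomputable section

namespace MultiLabel

/-- The label space `{-1, +1}^c`, with its (discrete) product `σ`-algebra. -/
abbrev Label (c : ℕ) : Type := Fin c → ({-1, 1} : Set ℝ)

/-- The positive definite symmetric kernel `κ` is the reproducing kernel of the reproducing kernel
Hilbert space `H` of real functions on `X`. -/
def IsReproducingKernel {X H : Type*} [NormedAddCommGroup H] [InnerProductSpace ℝ H]
    [CompleteSpace H] [RKHS ℝ H X ℝ] (κ : X → X → ℝ) : Prop :=
  (Matrix.of κ).PosSemidef ∧ ∀ x y, RKHS.kernel H x y 1 = κ x y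

/-- `φ : X → H` is a feature mapping associated with the kernel `κ`. -/
def IsFeatureMap {X H : Type*} [NormedAddCommGroup H] [InnerProductSpace ℝ H]
    (κ : X → X → ℝ) (φ : X → H) : Prop :=
  ∀ x y, inner ℝ (φ x) (φ y) = κ x y

/-- The norm `‖W‖_{H,2} = (∑ j, ‖w_j‖_H ^ 2) ^ (1/2)` of a family `W = (w_1, …, w_c)`. -/
def normH2 {H : Type*} [NormedAddCommGroup H] {c : ℕ} (W : Fin c → H) : ℝ :=
  √(∑ j, ‖W j‖ ^ 2)

/-- The function `x ↦ Wᵀ φ(x) = (⟨w_1, φ x⟩, …, ⟨w_c, φ x⟩)`, with values in Euclidean `ℝ^c`. -/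
def linearScore {X H : Type*} [NormedAddCommGroup H] [InnerProductSpace ℝ H] {c : ℕ}
    (φ : X → H) (W : Fin c → H) (x : X) : EuclideanSpace ℝ (Fin c) :=
  WithLp.toLp 2 fun j => inner ℝ (W j) (φ x)

/-- The kernel-based hypothesis set `{x ↦ Wᵀ φ(x) : ‖W‖_{H,2} ≤ Λ}`. -/
def kernelClass {X H : Type*} [NormedAddCommGroup H] [InnerProductSpace ℝ H]
    (c : ℕ) (φ : X → H) (Λ : ℝ) : Set (X → EuclideanSpace ℝ (Fin c)) :=
  {f | ∃ W : Fin c → H, normH2 W ≤ Λ ∧ f = linearScore φ W}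

/-- The expected risk `R(f) = E_{(x,y) ∼ D} [L(f(x), y)]`. -/
def risk {X : Type*} [MeasurableSpace X] {c : ℕ} (D : Measure (X × Label c))
    (L : EuclideanSpace ℝ (Fin c) → Label c → ℝ) (f : X → EuclideanSpace ℝ (Fin c)) : ℝ :=
  ∫ z, L (f z.1) z.2 ∂D

/-- The empirical risk `(1/n) ∑ i, L(f(x_i), y_i)` on the sample `S = ((x_i, y_i))_i`. -/
def empiricalRisk {X : Type*} {c n : ℕ} (L : EuclideanSpace ℝ (Fin c) → Label c → ℝ)
    (S : Fin n → X × Label c) (f : X → EuclideanSpace ℝ (Fin c)) : ℝ :=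
  1 / (n : ℝ) * ∑ i, L (f (S i).1) (S i).2

end MultiLabel

end

/-!
The bound is a Rademacher-complexity generalisation bound, proved by symmetrising the exponential
moment of the uniform deviation `sup_f (R(f) - R̂_S(f))`. A second sample and random exchanges of
entries between the two samples replace this deviation by a supremum of signed sums, for two fixed
samples (`measure_deviation_le`). There everything is finite: the supremum, as a function of the
signs, has bounded differences `2 * M / n`, so its exponential moment is controlled by its mean
(`expect_exp_le`), and the mean is controlled by the vector contraction inequality
(`expect_iSup_signed_sum_le`) followed by Cauchy-Schwarz (`expect_iSup_linearScore_le`). The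
constant `√2` in the contraction is the constant of the Khintchine inequality
(`norm_le_sqrt_two_mul_expect_abs`). Chernoff's bound then gives a tail `exp (-n τ² / (2 M²))`, and
the term `3 * M * √(log (2 / δ) / (2 * n))` is more than enough to make it at most `δ`.

The delicate point is measurability. The Hilbert space need not be separable (`κ(x, y) = 1` if
`x = y` and `0` otherwise is allowed), and the supremum over the kernel class need not be a countable
supremum over members of the class. By Bessel's inequality there is a separable closed subspace `K`
such that `⟪w, φ x⟫ = 0` for almost every `x` whenever `w ⊥ K` (`exists_separable_submodule`). Hence
the part of a weight vector orthogonal to `K` does not affect the risk, and the parts of the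
features orthogonal to `K` are pairwise orthogonal on almost every sample. On such a sample the orthogonal
part of `φ (x i)` may be replaced by a multiple of the `i`-th coordinate vector of `ℝ ^ n`
(`augmentedScore`). This does not change the attainable scores (`exists_augmentedScore_eq`,
`exists_linearScore_eq`), and the new parameters range over a separable set on which the deviation
is continuous, so that, up to a null set, the bad event is a countable union of measurable
sets. After passing to two samples one returns to the original class, where lower integrals of non-measurable
suprema suffice, because they are superadditive.
-/

namespace MultiLabel

section Cube

open scoped BigOperators

/-! ### Averages over the discrete cube -/

lemma expect_intUnits (f : ℤˣ → ℝ) : 𝔼 a, f a = (f 1 + f (-1)) / 2 := by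
  rw [Fintype.expect_eq_sum_div_card, UnitsInt.univ]
  simp

lemma expect_fin_cons {α : Type*} [Fintype α] {n : ℕ} (f : (Fin (n + 1) → α) → ℝ) :
    𝔼 ε, f ε = 𝔼 a, 𝔼 ε : Fin n → α, f (Fin.cons a ε) := by
  rw [← Fintype.expect_equiv (Fin.consEquiv fun _ => α) (fun p => f (Fin.cons p.1 p.2)) f
    (fun _ => rfl), ← Finset.univ_product_univ, Finset.expect_product]

lemma expect_signs_succ {n : ℕ} (f : (Fin (n + 1) → ℤˣ) → ℝ) :
    𝔼 ε, f ε = (𝔼 ε, f (Fin.cons 1 ε) + 𝔼 ε, f (Fin.cons (-1) ε)) / 2 := by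
  rw [expect_fin_cons, expect_intUnits]

lemma expect_comp_neg {α : Type*} [Fintype α] [InvolutiveNeg α] (f : α → ℝ) :
    𝔼 ε, f (-ε) = 𝔼 ε, f ε :=
  Fintype.expect_equiv (Equiv.neg α) _ _ fun _ => rfl

/-- The square of an average is at most the average of the square. -/
lemma sq_expect_le {α : Type*} [Fintype α] (f : α → ℝ) : (𝔼 a, f a) ^ 2 ≤ 𝔼 a, f a ^ 2 := by
  cases isEmpty_or_nonempty α
  · simp
  have h : 0 ≤ 𝔼 a, (f a - 𝔼 b, f b) ^ 2 := Finset.expect_nonneg fun _ _ => sq_nonneg _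
  have h' : 𝔼 a, (f a - 𝔼 b, f b) ^ 2 = 𝔼 a, f a ^ 2 - (𝔼 b, f b) ^ 2 := by
    simp_rw [sub_sq]
    rw [Finset.expect_add_distrib, Finset.expect_sub_distrib, ← Finset.expect_mul,
      ← Finset.mul_expect, Fintype.expect_const]
    ring
  linarith

/-! ### The Khintchine inequality with constant `√2` -/

/-- The Dirichlet form of a function on the discrete cube, normalised so that the character
indexed by `s` has energy `#s`. -/
noncomputable def energy {n : ℕ} (f : (Fin n → ℤˣ) → ℝ) : ℝ :=
  1 / 4 * ∑ i, 𝔼 ε, (f ε - f (Function.update ε i (-ε i))) ^ 2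

/-- The squared norm of the part of `f` that is linear in the signs. -/
noncomputable def linearWeight {n : ℕ} (f : (Fin n → ℤˣ) → ℝ) : ℝ :=
  ∑ i, (𝔼 ε, ((ε i : ℤ) : ℝ) * f ε) ^ 2

/-- The variance of a function on the discrete cube. -/
noncomputable def cubeVariance {n : ℕ} (f : (Fin n → ℤˣ) → ℝ) : ℝ :=
  𝔼 ε, f ε ^ 2 - (𝔼 ε, f ε) ^ 2

lemma energy_succ {n : ℕ} (f : (Fin (n + 1) → ℤˣ) → ℝ) :
    energy f = (energy (fun ε => f (Fin.cons 1 ε)) + energy (fun ε => f (Fin.cons (-1) ε))) / 2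
      + 1 / 4 * 𝔼 ε, (f (Fin.cons 1 ε) - f (Fin.cons (-1) ε)) ^ 2 := by
  have h (x y : ℝ) : (x - y) ^ 2 = (y - x) ^ 2 := by ring
  simp only [energy, Fin.sum_univ_succ, expect_signs_succ, Fin.cons_zero, Fin.cons_succ,
    Fin.update_cons_zero, ← Fin.cons_update, neg_neg]
  rw [← Finset.sum_div, Finset.sum_add_distrib]
  simp_rw [h (f (Fin.cons (-1) _)) (f (Fin.cons 1 _))]
  ring

lemma energy_add_energy {n : ℕ} (f g : (Fin n → ℤˣ) → ℝ) :
    (energy f + energy g) / 2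
      = energy (fun ε => (f ε + g ε) / 2) + energy (fun ε => (f ε - g ε) / 2) := by
  simp only [energy]
  rw [← mul_add, ← mul_add, mul_div_assoc, ← Finset.sum_add_distrib, ← Finset.sum_add_distrib,
    Finset.sum_div]
  congr 1
  refine Finset.sum_congr rfl fun i _ => ?_
  rw [← Finset.expect_add_distrib, ← Finset.expect_add_distrib, Finset.expect_div]
  exact Finset.expect_congr rfl fun ε _ => by ring

/-- The Poincaré inequality on the discrete cube. -/
lemma cubeVariance_le_energy {n : ℕ} (f : (Fin n → ℤˣ) → ℝ) : cubeVariance f ≤ energy f := by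
  induction n with
  | zero => simp [cubeVariance, energy]
  | succ n ih =>
    have h1 := ih fun ε => f (Fin.cons 1 ε)
    have h2 := ih fun ε => f (Fin.cons (-1) ε)
    have h3 := sq_expect_le fun ε : Fin n → ℤˣ => f (Fin.cons 1 ε) - f (Fin.cons (-1) ε)
    rw [Finset.expect_sub_distrib] at h3
    rw [energy_succ, cubeVariance, expect_signs_succ, expect_signs_succ]
    simp only [cubeVariance] at h1 h2
    nlinarith

/-- Functions without linear part have spectral gap at least `2`. -/
lemma two_mul_cubeVariance_le {n : ℕ} (f : (Fin n → ℤˣ) → ℝ) :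
    2 * cubeVariance f ≤ energy f + linearWeight f := by
  induction n with
  | zero => simp [cubeVariance, energy, linearWeight]
  | succ n ih =>
    -- The even and odd parts of `f` in its first variable.
    have h1 := ih fun ε => (f (Fin.cons 1 ε) + f (Fin.cons (-1) ε)) / 2
    have h2 := cubeVariance_le_energy fun ε => (f (Fin.cons 1 ε) - f (Fin.cons (-1) ε)) / 2
    have h3 : linearWeight f = (𝔼 ε, (f (Fin.cons 1 ε) - f (Fin.cons (-1) ε)) / 2) ^ 2
        + linearWeight fun ε => (f (Fin.cons 1 ε) + f (Fin.cons (-1) ε)) / 2 := by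
      simp only [linearWeight, Fin.sum_univ_succ, expect_signs_succ, Fin.cons_zero, Fin.cons_succ]
      congr 2
      · rw [← Finset.expect_add_distrib, Finset.expect_div]
        refine Finset.expect_congr rfl fun ε _ => ?_
        push_cast
        ring
      · funext i
        rw [← Finset.expect_add_distrib, Finset.expect_div]
        congr 1
        exact Finset.expect_congr rfl fun ε _ => by ring
    have h4 : cubeVariance f = cubeVariance (fun ε => (f (Fin.cons 1 ε) + f (Fin.cons (-1) ε)) / 2)
        + 𝔼 ε, ((f (Fin.cons 1 ε) - f (Fin.cons (-1) ε)) / 2) ^ 2 := by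
      simp only [cubeVariance, expect_signs_succ]
      rw [← Finset.expect_add_distrib, ← Finset.expect_add_distrib, Finset.expect_div,
        Finset.expect_div, sub_add_eq_add_sub, ← Finset.expect_add_distrib]
      congr 1
      exact Finset.expect_congr rfl fun ε _ => by ring
    have h5 : 𝔼 ε, ((f (Fin.cons 1 ε) - f (Fin.cons (-1) ε)) / 2) ^ 2
        = 1 / 4 * 𝔼 ε, (f (Fin.cons 1 ε) - f (Fin.cons (-1) ε)) ^ 2 := by
      rw [Finset.mul_expect]
      exact Finset.expect_congr rfl fun ε _ => by ring
    rw [energy_succ, energy_add_energy, h3, h4, ← h5]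
    simp only [cubeVariance] at h1 h2 ⊢
    linarith

lemma linearWeight_eq_zero {n : ℕ} {f : (Fin n → ℤˣ) → ℝ} (hf : ∀ ε, f (-ε) = f ε) :
    linearWeight f = 0 := by
  refine Finset.sum_eq_zero fun i _ => ?_
  have h := expect_comp_neg fun ε : Fin n → ℤˣ => ((ε i : ℤ) : ℝ) * f ε
  simp only [hf, Pi.neg_apply, Units.val_neg, Int.cast_neg, neg_mul,
    Finset.expect_neg_distrib] at h
  have : 𝔼 ε, ((ε i : ℤ) : ℝ) * f ε = 0 := by linarith
  simp [this]

/-- The average of the squared norm of a signed sum is the sum of the squared norms. The signs are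
odd functions of independent variables in `α`; this covers both the cube itself (`α = ℤˣ`) and one
column of a matrix of signs (`α = Fin c → ℤˣ`). -/
lemma expect_norm_sq_add_signed_sum {E α : Type*} [NormedAddCommGroup E] [InnerProductSpace ℝ E]
    [Fintype α] [Nonempty α] [InvolutiveNeg α] (sgn : α → ℤˣ) (hsgn : ∀ a, sgn (-a) = -sgn a)
    {n : ℕ} (v : Fin n → E) (x : E) :
    𝔼 ε : Fin n → α, ‖x + ∑ i, ((sgn (ε i) : ℤ) : ℝ) • v i‖ ^ 2 = ‖x‖ ^ 2 + ∑ i, ‖v i‖ ^ 2 := by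
  induction n generalizing x with
  | zero => simp
  | succ n ih =>
    have h1 : 𝔼 a, ‖x + ((sgn a : ℤ) : ℝ) • v 0‖ ^ 2 = ‖x‖ ^ 2 + ‖v 0‖ ^ 2 := by
      have h2 := expect_comp_neg fun a => ‖x + ((sgn a : ℤ) : ℝ) • v 0‖ ^ 2
      have h3 : 𝔼 a, (‖x + ((sgn a : ℤ) : ℝ) • v 0‖ ^ 2 + ‖x + ((sgn (-a) : ℤ) : ℝ) • v 0‖ ^ 2)
          = 𝔼 _a : α, 2 * (‖x‖ ^ 2 + ‖v 0‖ ^ 2) := by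
        refine Finset.expect_congr rfl fun a _ => ?_
        have := parallelogram_law_with_norm ℝ x (v 0)
        rcases Int.units_eq_one_or (sgn a) with h | h <;> simp [hsgn, h, ← sub_eq_add_neg] <;>
          linarith
      rw [Finset.expect_add_distrib, Fintype.expect_const] at h3
      linarith
    simp only [expect_fin_cons, Fin.sum_univ_succ, Fin.cons_zero, Fin.cons_succ, ← add_assoc, ih]
    rw [Finset.expect_add_distrib, h1, Fintype.expect_const]

lemma energy_abs_signed_sum_le {n : ℕ} (v : Fin n → ℝ) :
    energy (fun ε : Fin n → ℤˣ => |∑ i, ((ε i : ℤ) : ℝ) * v i|)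
      ≤ 𝔼 ε : Fin n → ℤˣ, |∑ i, ((ε i : ℤ) : ℝ) * v i| ^ 2 := by
  set f : (Fin n → ℤˣ) → ℝ := fun ε => |∑ i, ((ε i : ℤ) : ℝ) * v i| with hf
  have hflip (i : Fin n) (g : (Fin n → ℤˣ) → ℝ) :
      𝔼 ε, g (Function.update ε i (-ε i)) = 𝔼 ε, g ε := by
    have hinv : Function.Involutive fun ε : Fin n → ℤˣ => Function.update ε i (-ε i) := by
      intro ε
      simp
    exact Fintype.expect_equiv hinv.toPerm _ _ fun _ => rfl
  have h1 : energy f = 𝔼 ε, f ε * (1 / 2 * ∑ i, (f ε - f (Function.update ε i (-ε i)))) := by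
    have hi (i : Fin n) : 𝔼 ε, (f ε - f (Function.update ε i (-ε i))) ^ 2
        = 𝔼 ε, 2 * (f ε * (f ε - f (Function.update ε i (-ε i)))) := by
      have h2 := hflip i fun ε => f ε ^ 2
      have h3 : 𝔼 ε, (f ε - f (Function.update ε i (-ε i))) ^ 2
          = 𝔼 ε, (2 * (f ε * (f ε - f (Function.update ε i (-ε i))))
            + (f (Function.update ε i (-ε i)) ^ 2 - f ε ^ 2)) :=
        Finset.expect_congr rfl fun ε _ => by ring
      rw [h3, Finset.expect_add_distrib, Finset.expect_sub_distrib, h2]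
      ring
    rw [energy, Finset.sum_congr rfl fun i _ => hi i, ← Finset.expect_sum_comm, Finset.mul_expect]
    refine Finset.expect_congr rfl fun ε _ => ?_
    rw [← Finset.mul_sum, ← Finset.mul_sum]
    ring
  rw [h1]
  refine Finset.expect_le_expect fun ε _ => ?_
  -- Flipping one sign at a time, the `n` signed sums add up to `n - 2` times the original one.
  have h2 : (n - 2 : ℝ) * f ε ≤ ∑ i, f (Function.update ε i (-ε i)) := by
    have h3 (i : Fin n) : ∑ k, ((Function.update ε i (-ε i) k : ℤ) : ℝ) * v k
        = ∑ k, ((ε k : ℤ) : ℝ) * v k - 2 * (((ε i : ℤ) : ℝ) * v i) := by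
      rw [← Finset.add_sum_erase _ _ (Finset.mem_univ i),
        ← Finset.add_sum_erase _ (fun k => ((ε k : ℤ) : ℝ) * v k) (Finset.mem_univ i),
        Finset.sum_congr rfl fun k hk => by
          rw [Function.update_of_ne (Finset.ne_of_mem_erase hk)]]
      simp
      ring
    have h4 : ∑ i, ∑ k, ((Function.update ε i (-ε i) k : ℤ) : ℝ) * v k
        = (n - 2 : ℝ) * ∑ k, ((ε k : ℤ) : ℝ) * v k := by
      simp only [h3, Finset.sum_sub_distrib, ← Finset.mul_sum]
      simp
      ring
    calc (n - 2 : ℝ) * f ε ≤ |(n - 2 : ℝ)| * f ε :=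
          mul_le_mul_of_nonneg_right (le_abs_self _) (abs_nonneg _)
      _ = |∑ i, ∑ k, ((Function.update ε i (-ε i) k : ℤ) : ℝ) * v k| := by rw [h4, abs_mul]
      _ ≤ _ := Finset.abs_sum_le_sum_abs _ _
  rw [Finset.sum_sub_distrib, Finset.sum_const, Finset.card_univ, Fintype.card_fin, nsmul_eq_mul,
    sq]
  exact mul_le_mul_of_nonneg_left (by linarith) (abs_nonneg _)

/-- The Khintchine inequality with the optimal constant: the argument of Latała and Oleszkiewicz
compares the energy of the even function `ε ↦ |∑ ε_i v_i|` with its variance. -/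
lemma norm_le_sqrt_two_mul_expect_abs {n : ℕ} (v : EuclideanSpace ℝ (Fin n)) :
    ‖v‖ ≤ √2 * 𝔼 ε : Fin n → ℤˣ, |∑ i, ((ε i : ℤ) : ℝ) * v i| := by
  have h1 := energy_abs_signed_sum_le v
  have h2 := two_mul_cubeVariance_le fun ε : Fin n → ℤˣ => |∑ i, ((ε i : ℤ) : ℝ) * v i|
  rw [linearWeight_eq_zero fun ε => by
    simp [Finset.sum_neg_distrib, abs_neg], cubeVariance] at h2
  have h3 := expect_norm_sq_add_signed_sum (id : ℤˣ → ℤˣ) (fun _ => rfl) v 0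
  simp only [id, zero_add, norm_zero, smul_eq_mul, Real.norm_eq_abs, ne_eq, OfNat.ofNat_ne_zero,
    not_false_eq_true, zero_pow] at h3
  rw [h3] at h1 h2
  have h0 : 0 ≤ 𝔼 ε : Fin n → ℤˣ, |∑ i, ((ε i : ℤ) : ℝ) * v i| :=
    Finset.expect_nonneg fun _ _ => abs_nonneg _
  rw [EuclideanSpace.norm_eq]
  refine Real.sqrt_le_iff.2 ⟨by positivity, ?_⟩
  rw [mul_pow, Real.sq_sqrt zero_le_two]
  simp only [Real.norm_eq_abs]
  linarith

end Cube

section Rademacher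

open scoped BigOperators

/-! ### Vector contraction for Rademacher averages -/

lemma abs_signed_sum_le {n : ℕ} (ε : Fin n → ℤˣ) {a : Fin n → ℝ} {C : ℝ} (ha : ∀ i, |a i| ≤ C) :
    |∑ i, ((ε i : ℤ) : ℝ) * a i| ≤ n * C := by
  refine (Finset.abs_sum_le_sum_abs _ _).trans ?_
  calc ∑ i, |((ε i : ℤ) : ℝ) * a i| ≤ ∑ _i : Fin n, C := by
        refine Finset.sum_le_sum fun i _ => ?_
        rcases Int.units_eq_one_or (ε i) with h | h <;> simpa [h] using ha i
    _ = n * C := by simp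

lemma bddAbove_range_of_abs_le {B : Type*} {f : B → ℝ} {C : ℝ} (h : ∀ b, |f b| ≤ C) :
    BddAbove (Set.range f) :=
  ⟨C, by rintro _ ⟨b, rfl⟩; exact (le_abs_self _).trans (h b)⟩

/-- One step of the vector contraction: a scalar sign is traded for a vector of signs, the norm of
`s b - s b'` being bounded by a Rademacher average through the Khintchine inequality. -/
lemma expect_iSup_sign_le {B : Type*} [Nonempty B] {c : ℕ} {g ψ : B → ℝ}
    {s : B → EuclideanSpace ℝ (Fin c)} {μ C : ℝ} (hμ : 0 ≤ μ) (hg : ∀ b, |g b| ≤ C)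
    (hs : ∀ b j, |s b j| ≤ C) (hψ : ∀ b b', |ψ b - ψ b'| ≤ μ * ‖s b - s b'‖) :
    𝔼 a : ℤˣ, ⨆ b, (g b + ((a : ℤ) : ℝ) * ψ b)
      ≤ 𝔼 ε : Fin c → ℤˣ, ⨆ b, (g b + √2 * μ * ∑ j, ((ε j : ℤ) : ℝ) * s b j) := by
  set S : (Fin c → ℤˣ) → ℝ := fun ε => ⨆ b, (g b + √2 * μ * ∑ j, ((ε j : ℤ) : ℝ) * s b j) with hS
  have hle (ε : Fin c → ℤˣ) (b : B) : g b + √2 * μ * ∑ j, ((ε j : ℤ) : ℝ) * s b j ≤ S ε := by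
    refine le_ciSup (f := fun b => g b + √2 * μ * ∑ j, ((ε j : ℤ) : ℝ) * s b j)
      (bddAbove_range_of_abs_le (C := C + √2 * μ * (c * C)) fun b => ?_) b
    refine (abs_add_le _ _).trans (add_le_add (hg b) ?_)
    rw [abs_mul, abs_of_nonneg (by positivity : 0 ≤ √2 * μ)]
    exact mul_le_mul_of_nonneg_left (abs_signed_sum_le ε (hs b)) (by positivity)
  have key (b b' : B) : (g b + ψ b) + (g b' - ψ b') ≤ 2 * 𝔼 ε, S ε := by
    have h1 : 2 * 𝔼 ε, S ε = 𝔼 ε, (S ε + S (-ε)) := by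
      rw [Finset.expect_add_distrib, expect_comp_neg, two_mul]
    have h2 := norm_le_sqrt_two_mul_expect_abs (s b - s b')
    have h3 : 𝔼 ε : Fin c → ℤˣ, (g b + g b'
        + √2 * μ * |∑ j, ((ε j : ℤ) : ℝ) * (s b - s b') j|) ≤ 𝔼 ε, (S ε + S (-ε)) := by
      refine Finset.expect_le_expect fun ε _ => ?_
      have e1 : ∑ j, ((ε j : ℤ) : ℝ) * (s b - s b') j
          = ∑ j, ((ε j : ℤ) : ℝ) * s b j - ∑ j, ((ε j : ℤ) : ℝ) * s b' j := by
        simp [mul_sub, Finset.sum_sub_distrib]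
      have e2 (b : B) : ∑ j, (((-ε) j : ℤ) : ℝ) * s b j = -∑ j, ((ε j : ℤ) : ℝ) * s b j := by
        simp
      have l1 := hle ε b
      have l2 := hle ε b'
      have l3 := hle (-ε) b
      have l4 := hle (-ε) b'
      rw [e2] at l3 l4
      rw [e1]
      rcases abs_cases (∑ j, ((ε j : ℤ) : ℝ) * s b j - ∑ j, ((ε j : ℤ) : ℝ) * s b' j) with h | h <;>
        rw [h.1] <;> linarith
    rw [Finset.expect_add_distrib, Fintype.expect_const, ← Finset.mul_expect] at h3
    have h4 := (le_abs_self _).trans (hψ b b')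
    have h5 := mul_le_mul_of_nonneg_left h2 hμ
    rw [h1]
    linarith
  have h1 (b' : B) : (⨆ b, (g b + ψ b)) ≤ 2 * 𝔼 ε, S ε - (g b' - ψ b') :=
    ciSup_le fun b => by linarith [key b b']
  have h2 : (⨆ b, (g b - ψ b)) ≤ 2 * 𝔼 ε, S ε - ⨆ b, (g b + ψ b) :=
    ciSup_le fun b => by linarith [h1 b]
  rw [expect_intUnits]
  simp only [Units.val_one, Int.cast_one, one_mul, Units.val_neg, Int.cast_neg,
    neg_mul, ← sub_eq_add_neg]
  linarith

/-- The vector-valued contraction inequality for Rademacher averages. -/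
lemma expect_iSup_signed_sum_le {B : Type*} [Nonempty B] {c n : ℕ} {g : B → ℝ} {ψ : Fin n → B → ℝ}
    {s : Fin n → B → EuclideanSpace ℝ (Fin c)} {μ C C' : ℝ} (hμ : 0 ≤ μ) (hg : ∀ b, |g b| ≤ C')
    (hs : ∀ i b j, |s i b j| ≤ C) (hψC : ∀ i b, |ψ i b| ≤ C)
    (hψ : ∀ i b b', |ψ i b - ψ i b'| ≤ μ * ‖s i b - s i b'‖) :
    𝔼 σ : Fin n → ℤˣ, ⨆ b, (g b + ∑ i, ((σ i : ℤ) : ℝ) * ψ i b)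
      ≤ 𝔼 ε : Fin n → Fin c → ℤˣ,
        ⨆ b, (g b + ∑ i, √2 * μ * ∑ j, ((ε i j : ℤ) : ℝ) * s i b j) := by
  induction n generalizing g C' with
  | zero => simp
  | succ n ih =>
    rw [expect_fin_cons, expect_fin_cons]
    simp only [Fin.sum_univ_succ, Fin.cons_zero, Fin.cons_succ, ← add_assoc]
    calc 𝔼 a : ℤˣ, 𝔼 σ : Fin n → ℤˣ,
          ⨆ b, (g b + ((a : ℤ) : ℝ) * ψ 0 b + ∑ i, ((σ i : ℤ) : ℝ) * ψ i.succ b)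
        ≤ 𝔼 a : ℤˣ, 𝔼 ε : Fin n → Fin c → ℤˣ, ⨆ b, (g b + ((a : ℤ) : ℝ) * ψ 0 b
            + ∑ i, √2 * μ * ∑ j, ((ε i j : ℤ) : ℝ) * s i.succ b j) := by
          refine Finset.expect_le_expect fun a _ => ?_
          refine ih (C' := C' + C) (fun b => (abs_add_le _ _).trans (add_le_add (hg b) ?_))
            (fun i => hs i.succ) (fun i => hψC i.succ) fun i => hψ i.succ
          rcases Int.units_eq_one_or a with h | h <;> simpa [h] using hψC 0 b
      _ = 𝔼 ε : Fin n → Fin c → ℤˣ, 𝔼 a : ℤˣ, ⨆ b, (g b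
            + ∑ i, √2 * μ * ∑ j, ((ε i j : ℤ) : ℝ) * s i.succ b j + ((a : ℤ) : ℝ) * ψ 0 b) := by
          rw [Finset.expect_comm]
          simp only [add_right_comm]
      _ ≤ 𝔼 ε : Fin n → Fin c → ℤˣ, 𝔼 a : Fin c → ℤˣ, ⨆ b, (g b
            + ∑ i, √2 * μ * ∑ j, ((ε i j : ℤ) : ℝ) * s i.succ b j
            + √2 * μ * ∑ j, ((a j : ℤ) : ℝ) * s 0 b j) := by
          refine Finset.expect_le_expect fun ε _ => ?_
          refine expect_iSup_sign_le (C := max (C' + n * (√2 * μ * (c * C))) C) hμ (fun b => ?_)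
            (fun b j => (hs 0 b j).trans (le_max_right _ _)) (hψ 0)
          refine le_trans ((abs_add_le _ _).trans (add_le_add (hg b) ?_)) (le_max_left _ _)
          refine (Finset.abs_sum_le_sum_abs _ _).trans ?_
          calc ∑ i, |√2 * μ * ∑ j, ((ε i j : ℤ) : ℝ) * s i.succ b j|
              ≤ ∑ _i : Fin n, √2 * μ * (c * C) := by
                refine Finset.sum_le_sum fun i _ => ?_
                rw [abs_mul, abs_of_nonneg (by positivity : 0 ≤ √2 * μ)]
                exact mul_le_mul_of_nonneg_left (abs_signed_sum_le _ (hs i.succ b)) (by positivity)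
            _ = _ := by simp
      _ = _ := by
          rw [Finset.expect_comm]
          simp only [add_right_comm]

/-! ### Concentration on the discrete cube -/

/-- The bounded differences inequality on the discrete cube, in exponential form. -/
lemma expect_exp_le {n : ℕ} {F : (Fin n → ℤˣ) → ℝ} {d : ℝ}
    (hF : ∀ ε i, |F ε - F (Function.update ε i (-ε i))| ≤ d) (s : ℝ) :
    𝔼 ε, Real.exp (s * F ε) ≤ Real.exp (s * 𝔼 ε, F ε + n * (s ^ 2 * d ^ 2 / 8)) := by
  induction n with
  | zero => simp
  | succ n ih =>
    have ih' (a : ℤˣ) := ih (F := fun ε => F (Fin.cons a ε)) fun ε i => by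
      simpa [← Fin.cons_update] using hF (Fin.cons a ε) i.succ
    set p := 𝔼 ε, F (Fin.cons 1 ε)
    set q := 𝔼 ε, F (Fin.cons (-1) ε)
    have hpq : |p - q| ≤ d := by
      rw [← Finset.expect_sub_distrib]
      refine (Finset.abs_expect_le _ _).trans ?_
      refine (Finset.expect_le_expect (g := fun _ => d) fun ε _ => ?_).trans
        (Fintype.expect_const d).le
      simpa using hF (Fin.cons 1 ε) 0
    have hcosh : Real.cosh (s * (p - q) / 2) ≤ Real.exp (s ^ 2 * d ^ 2 / 8) := by
      refine (Real.cosh_le_exp_half_sq _).trans (Real.exp_le_exp.2 ?_)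
      have : (p - q) ^ 2 ≤ d ^ 2 := by
        rw [← sq_abs]
        exact pow_le_pow_left₀ (abs_nonneg _) hpq 2
      nlinarith [mul_le_mul_of_nonneg_left this (sq_nonneg s)]
    rw [expect_signs_succ, expect_signs_succ]
    calc (𝔼 ε, Real.exp (s * F (Fin.cons 1 ε)) + 𝔼 ε, Real.exp (s * F (Fin.cons (-1) ε))) / 2
        ≤ (Real.exp (s * p + n * (s ^ 2 * d ^ 2 / 8))
            + Real.exp (s * q + n * (s ^ 2 * d ^ 2 / 8))) / 2 := by
          linarith [ih' 1, ih' (-1)]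
      _ = Real.exp (s * ((p + q) / 2) + n * (s ^ 2 * d ^ 2 / 8))
            * Real.cosh (s * (p - q) / 2) := by
          have e1 : s * p + n * (s ^ 2 * d ^ 2 / 8)
              = s * ((p + q) / 2) + n * (s ^ 2 * d ^ 2 / 8) + s * (p - q) / 2 := by ring
          have e2 : s * q + n * (s ^ 2 * d ^ 2 / 8)
              = s * ((p + q) / 2) + n * (s ^ 2 * d ^ 2 / 8) + -(s * (p - q) / 2) := by ring
          rw [Real.cosh_eq, e1, e2, Real.exp_add _ (s * (p - q) / 2),
            Real.exp_add _ (-(s * (p - q) / 2))]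
          ring
      _ ≤ Real.exp (s * ((p + q) / 2) + n * (s ^ 2 * d ^ 2 / 8))
            * Real.exp (s ^ 2 * d ^ 2 / 8) :=
          mul_le_mul_of_nonneg_left hcosh (Real.exp_pos _).le
      _ = Real.exp (s * ((p + q) / 2) + (n + 1 : ℕ) * (s ^ 2 * d ^ 2 / 8)) := by
          rw [← Real.exp_add]
          push_cast
          ring_nf

lemma abs_iSup_signed_sum_sub_le {B : Type*} [Nonempty B] {n : ℕ} {a : Fin n → B → ℝ} {M : ℝ}
    (ha : ∀ i b, |a i b| ≤ M) (ε : Fin n → ℤˣ) (k : Fin n) :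
    |(⨆ b, ∑ i, ((ε i : ℤ) : ℝ) * a i b)
      - ⨆ b, ∑ i, ((Function.update ε k (-ε k) i : ℤ) : ℝ) * a i b| ≤ 2 * M := by
  have h1 (ε : Fin n → ℤˣ) (k : Fin n) (b : B) : ∑ i, ((ε i : ℤ) : ℝ) * a i b
      ≤ ∑ i, ((Function.update ε k (-ε k) i : ℤ) : ℝ) * a i b + 2 * M := by
    rw [← Finset.add_sum_erase _ _ (Finset.mem_univ k),
      ← Finset.add_sum_erase _ (fun i => ((Function.update ε k (-ε k) i : ℤ) : ℝ) * a i b)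
        (Finset.mem_univ k),
      Finset.sum_congr rfl fun i hi => by
        rw [← Function.update_of_ne (Finset.ne_of_mem_erase hi) (-ε k) ε]]
    have := abs_le.1 (ha k b)
    rcases Int.units_eq_one_or (ε k) with h | h <;> simp [h] <;> linarith
  have h2 (ε : Fin n → ℤˣ) (k : Fin n) : (⨆ b, ∑ i, ((ε i : ℤ) : ℝ) * a i b)
      ≤ (⨆ b, ∑ i, ((Function.update ε k (-ε k) i : ℤ) : ℝ) * a i b) + 2 * M := by
    refine ciSup_le fun b => (h1 ε k b).trans (add_le_add_left ?_ _)
    exact le_ciSup (f := fun b => ∑ i, ((Function.update ε k (-ε k) i : ℤ) : ℝ) * a i b)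
      (bddAbove_range_of_abs_le fun b => abs_signed_sum_le _ fun i => ha i b) b
  have h3 := h2 ε k
  have h4 := h2 (Function.update ε k (-ε k)) k
  simp only [Function.update_self, neg_neg, Function.update_idem, Function.update_eq_self] at h4
  exact abs_sub_le_iff.2 ⟨by linarith, by linarith⟩

end Rademacher

section KernelRademacher

open scoped BigOperators

variable {X H : Type*} [NormedAddCommGroup H]

/-! ### The symmetrised kernel class -/

lemma sum_norm_sq_le_of_normH2_le {c : ℕ} {W : Fin c → H} {Λ : ℝ} (hW : normH2 W ≤ Λ) :
    ∑ j, ‖W j‖ ^ 2 ≤ Λ ^ 2 :=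
  (Real.sqrt_le_left ((Real.sqrt_nonneg _).trans hW)).1 hW

lemma normH2_le_of_sum_norm_sq_le {c : ℕ} {W : Fin c → H} {Λ : ℝ} (hΛ : 0 ≤ Λ)
    (hW : ∑ j, ‖W j‖ ^ 2 ≤ Λ ^ 2) : normH2 W ≤ Λ :=
  Real.sqrt_le_iff.2 ⟨hΛ, hW⟩

lemma norm_le_of_normH2_le {c : ℕ} {W : Fin c → H} {Λ : ℝ} (hW : normH2 W ≤ Λ) (j : Fin c) :
    ‖W j‖ ≤ Λ := by
  refine abs_le_of_sq_le_sq' ?_ ((Real.sqrt_nonneg _).trans hW) |>.2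
  exact (Finset.single_le_sum (f := fun j => ‖W j‖ ^ 2) (fun _ _ => sq_nonneg _)
    (Finset.mem_univ j)).trans (sum_norm_sq_le_of_normH2_le hW)

variable [InnerProductSpace ℝ H]

/-- The Rademacher average, with independent signs in all coordinates, of the kernel class. -/
lemma expect_iSup_linearScore_le {c n : ℕ} {Λ r t : ℝ} (hΛ : 0 ≤ Λ) (ht : 0 ≤ t)
    {φ : X → H} (hφ : ∀ x, ‖φ x‖ ≤ r) (x : Fin n → X) :
    𝔼 ε : Fin n → Fin c → ℤˣ, ⨆ W : {W : Fin c → H // normH2 W ≤ Λ},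
        ∑ i, t * ∑ j, ((ε i j : ℤ) : ℝ) * linearScore φ W.1 (x i) j
      ≤ t * (Λ * √(n * c * r ^ 2)) := by
  have : Nonempty {W : Fin c → H // normH2 W ≤ Λ} := ⟨0, by simpa [normH2] using hΛ⟩
  set V : (Fin n → Fin c → ℤˣ) → Fin c → H := fun ε j => ∑ i, ((ε i j : ℤ) : ℝ) • φ (x i)
  have h1 (ε : Fin n → Fin c → ℤˣ) : (⨆ W : {W : Fin c → H // normH2 W ≤ Λ},
        ∑ i, t * ∑ j, ((ε i j : ℤ) : ℝ) * linearScore φ W.1 (x i) j) ≤ t * (Λ * normH2 (V ε)) := by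
    refine ciSup_le fun W => ?_
    rw [← Finset.mul_sum]
    refine mul_le_mul_of_nonneg_left ?_ ht
    calc ∑ i, ∑ j, ((ε i j : ℤ) : ℝ) * linearScore φ W.1 (x i) j
        = ∑ j, inner ℝ (W.1 j) (V ε j) := by
          rw [Finset.sum_comm]
          simp [V, linearScore, inner_sum, inner_smul_right]
      _ ≤ ∑ j, ‖W.1 j‖ * ‖V ε j‖ := Finset.sum_le_sum fun j _ => real_inner_le_norm _ _
      _ ≤ normH2 W.1 * normH2 (V ε) := Real.sum_mul_le_sqrt_mul_sqrt _ _ _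
      _ ≤ Λ * normH2 (V ε) := mul_le_mul_of_nonneg_right W.2 (Real.sqrt_nonneg _)
  refine (Finset.expect_le_expect fun ε _ => h1 ε).trans ?_
  rw [← Finset.mul_expect, ← Finset.mul_expect]
  refine mul_le_mul_of_nonneg_left (mul_le_mul_of_nonneg_left (Real.le_sqrt_of_sq_le ?_) hΛ) ht
  refine (sq_expect_le _).trans ?_
  have h2 (ε : Fin n → Fin c → ℤˣ) : normH2 (V ε) ^ 2 = ∑ j, ‖V ε j‖ ^ 2 :=
    Real.sq_sqrt (Finset.sum_nonneg fun _ _ => sq_nonneg _)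
  simp only [h2]
  rw [Finset.expect_sum_comm]
  calc ∑ j : Fin c, 𝔼 ε, ‖V ε j‖ ^ 2 = ∑ _j : Fin c, ∑ i, ‖φ (x i)‖ ^ 2 := by
        refine Finset.sum_congr rfl fun j _ => ?_
        simpa using expect_norm_sq_add_signed_sum (fun a : Fin c → ℤˣ => a j) (fun _ => rfl)
          (fun i => φ (x i)) 0
    _ ≤ ∑ _j : Fin c, ∑ _i : Fin n, r ^ 2 :=
        Finset.sum_le_sum fun j _ => Finset.sum_le_sum fun i _ =>
          pow_le_pow_left₀ (norm_nonneg _) (hφ _) 2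
    _ = n * c * r ^ 2 := by
        simp
        ring

lemma abs_linearScore_le {c : ℕ} {Λ r : ℝ} {φ : X → H} (hφ : ∀ x, ‖φ x‖ ≤ r) {W : Fin c → H}
    (hW : normH2 W ≤ Λ) (x : X) (j : Fin c) : |linearScore φ W x j| ≤ Λ * r :=
  (abs_real_inner_le_norm _ _).trans <| mul_le_mul (norm_le_of_normH2_le hW j) (hφ x)
    (norm_nonneg _) ((Real.sqrt_nonneg _).trans hW)

/-- The Rademacher average of the loss class over the kernel class. -/
lemma expect_iSup_loss_le {c n : ℕ} {Λ r M μ : ℝ} (hΛ : 0 ≤ Λ) (hμ : 0 ≤ μ)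
    {φ : X → H} (hφ : ∀ x, ‖φ x‖ ≤ r) (x : Fin n → X)
    {ℓ : Fin n → EuclideanSpace ℝ (Fin c) → ℝ} (hℓM : ∀ i u, |ℓ i u| ≤ M)
    (hℓ : ∀ i u v, |ℓ i u - ℓ i v| ≤ μ * ‖u - v‖) :
    𝔼 σ : Fin n → ℤˣ, ⨆ W : {W : Fin c → H // normH2 W ≤ Λ},
        ∑ i, ((σ i : ℤ) : ℝ) * ℓ i (linearScore φ W.1 (x i))
      ≤ √2 * μ * (Λ * √(n * c * r ^ 2)) := by
  have : Nonempty {W : Fin c → H // normH2 W ≤ Λ} := ⟨0, by simpa [normH2] using hΛ⟩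
  refine le_trans ?_ (expect_iSup_linearScore_le hΛ (by positivity : 0 ≤ √2 * μ) hφ x)
  simpa using expect_iSup_signed_sum_le
    (B := {W : Fin c → H // normH2 W ≤ Λ}) (g := fun _ => 0) (C' := 0) (C := max M (Λ * r))
    (ψ := fun i W => ℓ i (linearScore φ W.1 (x i))) (s := fun i W => linearScore φ W.1 (x i))
    hμ (by simp) (fun i W j => (abs_linearScore_le hφ W.2 _ _).trans (le_max_right _ _))
    (fun i W => (hℓM _ _).trans (le_max_left _ _)) fun i W W' => hℓ _ _ _

/-- Exponential moments, over the signs, of the symmetrised deviation between two fixed samples. -/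
lemma expect_exp_iSup_symmetrised_le {c n : ℕ} (hn : 0 < n) {Λ r M s : ℝ} {μ : ℝ≥0} (hΛ : 0 ≤ Λ)
    (hs : 0 ≤ s) {φ : X → H} (hφ : ∀ x, ‖φ x‖ ≤ r)
    {L : EuclideanSpace ℝ (Fin c) → Label c → ℝ}
    (hL0 : ∀ u y, 0 ≤ L u y) (hLM : ∀ u y, L u y ≤ M) (hLip : ∀ y, LipschitzWith μ fun u => L u y)
    (z z' : Fin n → X × Label c) :
    𝔼 σ : Fin n → ℤˣ, Real.exp (s * ⨆ W : {W : Fin c → H // normH2 W ≤ Λ},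
        1 / (n : ℝ) * ∑ i, ((σ i : ℤ) : ℝ)
          * (L (linearScore φ W.1 (z' i).1) (z' i).2 - L (linearScore φ W.1 (z i).1) (z i).2))
      ≤ Real.exp (s * (2 * √2 * μ * √(c * Λ ^ 2 * r ^ 2 / n)) + s ^ 2 * M ^ 2 / (2 * n)) := by
  have hne : Nonempty {W : Fin c → H // normH2 W ≤ Λ} := ⟨0, by simpa [normH2] using hΛ⟩
  have hn' : (0 : ℝ) < n := Nat.cast_pos.2 hn
  set a : Fin n → {W : Fin c → H // normH2 W ≤ Λ} → ℝ := fun i W =>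
    L (linearScore φ W.1 (z' i).1) (z' i).2 - L (linearScore φ W.1 (z i).1) (z i).2 with ha
  have haM (i) (W) : |a i W| ≤ M := abs_sub_le_of_nonneg_of_le (hL0 _ _) (hLM _ _) (hL0 _ _)
    (hLM _ _)
  have hLabs (u y) : |L u y| ≤ M := by rw [abs_of_nonneg (hL0 _ _)]; exact hLM _ _
  have hLip' (u v y) : |L u y - L v y| ≤ μ * ‖u - v‖ := by
    simpa [Real.dist_eq, dist_eq_norm] using (hLip y).dist_le_mul u v
  have hbdd (ℓ : Fin n → EuclideanSpace ℝ (Fin c) → ℝ) (hℓ : ∀ i u, |ℓ i u| ≤ M)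
      (x : Fin n → X) (σ : Fin n → ℤˣ) : BddAbove (Set.range fun W : {W : Fin c → H //
        normH2 W ≤ Λ} => ∑ i, ((σ i : ℤ) : ℝ) * ℓ i (linearScore φ W.1 (x i))) :=
    bddAbove_range_of_abs_le fun W => abs_signed_sum_le σ fun i => hℓ i _
  have hmean : 𝔼 σ : Fin n → ℤˣ, (⨆ W, ∑ i, ((σ i : ℤ) : ℝ) * a i W)
      ≤ 2 * (√2 * μ * (Λ * √(n * c * r ^ 2))) := by
    have h1 := expect_iSup_loss_le hΛ μ.2 hφ (fun i => (z' i).1)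
      (ℓ := fun i u => L u (z' i).2) (fun _ _ => hLabs _ _) (fun _ _ _ => hLip' _ _ _)
    have h2 := expect_iSup_loss_le hΛ μ.2 hφ (fun i => (z i).1)
      (ℓ := fun i u => -L u (z i).2) (fun _ _ => by rw [abs_neg]; exact hLabs _ _)
      (fun i u v => by rw [neg_sub_neg, abs_sub_comm]; exact hLip' _ _ _)
    rw [two_mul]
    refine le_trans ?_ (add_le_add h1 h2)
    rw [← Finset.expect_add_distrib]
    refine Finset.expect_le_expect fun σ _ => ciSup_le fun W => ?_
    refine le_trans (le_of_eq ?_) (add_le_add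
      (le_ciSup (hbdd (fun i u => L u (z' i).2) (fun _ _ => hLabs _ _) _ σ) W)
      (le_ciSup (hbdd (fun i u => -L u (z i).2)
        (fun _ _ => by rw [abs_neg]; exact hLabs _ _) _ σ) W))
    rw [← Finset.sum_add_distrib]
    exact Finset.sum_congr rfl fun i _ => by simp only [ha]; ring
  have hconst : 1 / (n : ℝ) * (2 * (√2 * μ * (Λ * √(n * c * r ^ 2))))
      = 2 * √2 * μ * √(c * Λ ^ 2 * r ^ 2 / n) := by
    have : √(c * Λ ^ 2 * r ^ 2 / n) = Λ * √(n * c * r ^ 2) / n := by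
      rw [show c * Λ ^ 2 * r ^ 2 / n = (Λ / n) ^ 2 * (n * c * r ^ 2) by field_simp,
        Real.sqrt_mul (sq_nonneg _), Real.sqrt_sq (by positivity)]
      ring
    rw [this]
    ring
  have hmc := expect_exp_le (F := fun σ : Fin n → ℤˣ => 1 / (n : ℝ) * ⨆ W, ∑ i,
    ((σ i : ℤ) : ℝ) * a i W) (d := 2 * M / n) (fun ε i => by
      rw [← mul_sub, abs_mul, abs_of_pos (by positivity)]
      have := mul_le_mul_of_nonneg_left (abs_iSup_signed_sum_sub_le haM ε i)
        (by positivity : 0 ≤ 1 / (n : ℝ))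
      exact this.trans_eq (by ring)) s
  simp only [← Real.mul_iSup_of_nonneg (by positivity : 0 ≤ 1 / (n : ℝ))]
  refine hmc.trans (Real.exp_le_exp.2 (add_le_add (mul_le_mul_of_nonneg_left ?_ hs) ?_))
  · rw [← Finset.mul_expect, ← hconst]
    exact mul_le_mul_of_nonneg_left hmean (by positivity)
  · refine le_of_eq ?_
    field_simp
    ring

end KernelRademacher

section Separability

variable {X H : Type*} [MeasurableSpace X] [NormedAddCommGroup H] [InnerProductSpace ℝ H]

/-! ### Measurability and separable reduction of the feature map -/

/-- A feature map of a measurable kernel is weakly measurable: this is clear against the vectors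
`φ y`, hence against their closed linear span, and trivial against its orthogonal complement. -/
lemma measurable_inner_featureMap [CompleteSpace H] {κ : X → X → ℝ}
    (hκm : Measurable fun p : X × X => κ p.1 p.2) {φ : X → H} (hφ : IsFeatureMap κ φ) (w : H) :
    Measurable fun x => (inner ℝ w (φ x) : ℝ) := by
  set K := (Submodule.span ℝ (Set.range φ)).topologicalClosure with hK
  have : CompleteSpace K := (Submodule.isClosed_topologicalClosure _).completeSpace_coe
  have hφK (x : X) : φ x ∈ K :=
    Submodule.le_topologicalClosure _ (Submodule.subset_span ⟨x, rfl⟩)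
  have hspan : ∀ v ∈ Submodule.span ℝ (Set.range φ),
      Measurable fun x => (inner ℝ v (φ x) : ℝ) := by
    intro v hv
    induction hv using Submodule.span_induction with
    | mem v hv =>
      obtain ⟨y, rfl⟩ := hv
      simp only [hφ y]
      exact hκm.comp measurable_prodMk_left
    | zero => simp
    | add u v _ _ hu hv =>
      simp only [inner_add_left]
      exact hu.add hv
    | smul a v _ hv => simpa only [real_inner_smul_left] using hv.const_mul a
  have hclos : ∀ v ∈ K, Measurable fun x => (inner ℝ v (φ x) : ℝ) := by
    intro v hv
    obtain ⟨u, hu, hlim⟩ := mem_closure_iff_seq_limit.1 hv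
    exact measurable_of_tendsto_metrizable (fun k => hspan _ (hu k))
      (tendsto_pi_nhds.2 fun x => hlim.inner tendsto_const_nhds)
  have hproj (x : X) : (inner ℝ w (φ x) : ℝ) = inner ℝ (K.starProjection w) (φ x) := by
    rw [Submodule.inner_starProjection_left_eq_right,
      Submodule.starProjection_eq_self_iff.2 (hφK x)]
  simp only [hproj]
  exact hclos _ (Submodule.starProjection_apply_mem _ _)

/-- Up to functions that vanish almost everywhere, the functions `x ↦ ⟪w, φ x⟫` are parametrised
by a separable subspace: by Bessel's inequality only countably many members of a Hilbert basis give
functions that do not vanish almost everywhere. -/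
lemma exists_separable_submodule [CompleteSpace H] (P : Measure X) [IsFiniteMeasure P] {φ : X → H}
    (hφm : ∀ w, Measurable fun x => (inner ℝ w (φ x) : ℝ)) {r : ℝ} (hφr : ∀ x, ‖φ x‖ ≤ r) :
    ∃ (K : Submodule ℝ H) (_ : K.HasOrthogonalProjection),
      TopologicalSpace.IsSeparable (K : Set H) ∧
        ∀ w ∈ Kᗮ, ∀ᵐ x ∂P, (inner ℝ w (φ x) : ℝ) = 0 := by
  obtain ⟨ι, b, -⟩ := exists_hilbertBasis ℝ H
  have hsq (w : H) : Integrable (fun x => (inner ℝ w (φ x) : ℝ) ^ 2) P := by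
    refine Integrable.of_bound ((hφm w).pow_const 2).aestronglyMeasurable ((‖w‖ * r) ^ 2)
      (Filter.Eventually.of_forall fun x => ?_)
    rw [norm_pow]
    exact pow_le_pow_left₀ (norm_nonneg _) ((norm_inner_le_norm _ _).trans
      (mul_le_mul_of_nonneg_left (hφr x) (norm_nonneg _))) 2
  set I : ι → ℝ := fun α => ∫ x, (inner ℝ (b α) (φ x) : ℝ) ^ 2 ∂P with hI
  have hI0 (α) : 0 ≤ I α := integral_nonneg fun _ => sq_nonneg _
  have hsum : Summable I := by
    refine summable_of_sum_le (c := ∫ _x, r ^ 2 ∂P) hI0 fun u => ?_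
    rw [← integral_finsetSum _ fun α _ => hsq _]
    refine integral_mono (integrable_finsetSum _ fun α _ => hsq _) (integrable_const _) fun x => ?_
    have h1 := b.orthonormal.sum_inner_products_le (φ x) (s := u)
    simp only [Real.norm_eq_abs, sq_abs] at h1
    exact h1.trans (pow_le_pow_left₀ (norm_nonneg _) (hφr x) 2)
  have hzero (α) (hα : I α = 0) : ∀ᵐ x ∂P, (inner ℝ (b α) (φ x) : ℝ) = 0 := by
    have := (integral_eq_zero_iff_of_nonneg (fun _ => sq_nonneg _) (hsq (b α))).1 hα
    filter_upwards [this] with x hx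
    exact pow_eq_zero_iff two_ne_zero |>.1 hx
  set K := (Submodule.span ℝ (b '' Function.support I)).topologicalClosure with hK
  have : CompleteSpace K := (Submodule.isClosed_topologicalClosure _).completeSpace_coe
  refine ⟨K, inferInstance, ?_, fun w hw => ?_⟩
  · rw [hK, Submodule.topologicalClosure_coe]
    exact ((hsum.countable_support.image b).isSeparable.span (R := ℝ)).closure
  · have hbw (α : ι) (hα : I α ≠ 0) : (inner ℝ w (b α) : ℝ) = 0 :=
      Submodule.inner_left_of_mem_orthogonal
        (Submodule.le_topologicalClosure (Submodule.span ℝ (b '' Function.support I))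
          (Submodule.subset_span (Set.mem_image_of_mem b hα))) hw
    have hcount := (b.hasSum_inner_mul_inner w w).summable.countable_support
    have hae : ∀ᵐ x ∂P, ∀ α ∈ Function.support fun α => (inner ℝ w (b α) * inner ℝ (b α) w : ℝ),
        (inner ℝ (b α) (φ x) : ℝ) = 0 := by
      refine (ae_ball_iff hcount).2 fun α hα => hzero α ?_
      by_contra h
      exact hα (by simp [hbw α h])
    filter_upwards [hae] with x hx
    refine (b.hasSum_inner_mul_inner w (φ x)).unique ?_
    convert hasSum_zero using 2 with α
    by_cases h : (inner ℝ w (b α) : ℝ) = 0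
    · rw [h, zero_mul]
    · rw [hx α (by simpa [real_inner_comm] using h), mul_zero]

/-- The squared norm of the projection to a separable subspace, as a countable supremum. -/
lemma iSup_two_mul_inner_sub_eq (K : Submodule ℝ H) [K.HasOrthogonalProjection] {d : ℕ → H}
    (hdK : ∀ k, d k ∈ K) (hd : ∀ v ∈ K, v ∈ closure (Set.range d)) (v : H) :
    ⨆ k, (2 * inner ℝ (d k) v - ‖d k‖ ^ 2) = ‖K.starProjection v‖ ^ 2 := by
  have h (k : ℕ) : 2 * inner ℝ (d k) v - ‖d k‖ ^ 2
      = ‖K.starProjection v‖ ^ 2 - ‖K.starProjection v - d k‖ ^ 2 := by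
    have : inner ℝ (d k) v = (inner ℝ (K.starProjection v) (d k) : ℝ) := by
      rw [Submodule.inner_starProjection_left_eq_right,
        Submodule.starProjection_eq_self_iff.2 (hdK k), real_inner_comm]
    rw [this, norm_sub_sq_real]
    ring
  refine ciSup_eq_of_forall_le_of_forall_lt_exists_gt (fun k => ?_) fun t ht => ?_
  · rw [h]
    nlinarith [sq_nonneg ‖K.starProjection v - d k‖]
  · obtain ⟨_, ⟨k, rfl⟩, hk⟩ := Metric.mem_closure_iff.1
      (hd _ (K.starProjection_apply_mem v)) (√(‖K.starProjection v‖ ^ 2 - t))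
      (Real.sqrt_pos.2 (sub_pos.2 ht))
    refine ⟨k, ?_⟩
    rw [dist_eq_norm, Real.lt_sqrt (norm_nonneg _)] at hk
    rw [h]
    linarith

lemma measurable_norm_sq_starProjection {Y : Type*} [MeasurableSpace Y] (K : Submodule ℝ H)
    [K.HasOrthogonalProjection] (hK : TopologicalSpace.IsSeparable (K : Set H)) {f : Y → H}
    (hf : ∀ w, Measurable fun y => (inner ℝ w (f y) : ℝ)) :
    Measurable fun y => ‖K.starProjection (f y)‖ ^ 2 := by
  obtain ⟨t, htK, htc, hKt⟩ := hK.exists_countable_dense_subset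
  have htne : t.Nonempty := closure_nonempty_iff.1 ⟨0, hKt K.zero_mem⟩
  obtain ⟨d, rfl⟩ := htc.exists_eq_range htne
  simp only [← iSup_two_mul_inner_sub_eq K (fun k => htK ⟨k, rfl⟩) hKt]
  exact Measurable.iSup fun k => ((hf (d k)).const_mul 2).sub_const _

/-- Joint measurability of the kernel of the component of `φ` orthogonal to a separable
subspace. -/
lemma measurable_inner_orthogonal_starProjection {κ : X → X → ℝ}
    (hκm : Measurable fun p : X × X => κ p.1 p.2) {φ : X → H} (hφ : IsFeatureMap κ φ)
    (hφm : ∀ w, Measurable fun x => (inner ℝ w (φ x) : ℝ))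
    (K : Submodule ℝ H) [K.HasOrthogonalProjection]
    (hK : TopologicalSpace.IsSeparable (K : Set H)) :
    Measurable fun p : X × X =>
      (inner ℝ (Kᗮ.starProjection (φ p.1)) (Kᗮ.starProjection (φ p.2)) : ℝ) := by
  have h (p : X × X) : (inner ℝ (Kᗮ.starProjection (φ p.1)) (Kᗮ.starProjection (φ p.2)) : ℝ)
      = κ p.1 p.2 - (‖K.starProjection (φ p.1 + φ p.2)‖ ^ 2
        - ‖K.starProjection (φ p.1 - φ p.2)‖ ^ 2) / 4 := by
    have h1 : (inner ℝ (Kᗮ.starProjection (φ p.1)) (Kᗮ.starProjection (φ p.2)) : ℝ)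
        = inner ℝ (φ p.1) (φ p.2)
          - inner ℝ (K.starProjection (φ p.1)) (K.starProjection (φ p.2)) := by
      rw [Submodule.inner_starProjection_left_eq_right,
        Submodule.starProjection_eq_self_iff.2 (Kᗮ.starProjection_apply_mem _),
        Submodule.starProjection_orthogonal_val, inner_sub_right,
        Submodule.inner_starProjection_left_eq_right K,
        Submodule.starProjection_eq_self_iff.2 (K.starProjection_apply_mem _)]
    rw [h1, hφ, map_add, map_sub, norm_add_sq_real, norm_sub_sq_real]
    ring
  simp only [h]
  have hadd := measurable_norm_sq_starProjection (Y := X × X) K hK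
    (f := fun p => φ p.1 + φ p.2) fun w => by
      simp only [inner_add_right]
      exact ((hφm w).comp measurable_fst).add ((hφm w).comp measurable_snd)
  have hsub := measurable_norm_sq_starProjection (Y := X × X) K hK
    (f := fun p => φ p.1 - φ p.2) fun w => by
      simp only [inner_sub_right]
      exact ((hφm w).comp measurable_fst).sub ((hφm w).comp measurable_snd)
  exact hκm.sub ((hadd.sub hsub).div_const 4)

end Separability

section Augmented

variable {X H : Type*} [NormedAddCommGroup H] [InnerProductSpace ℝ H]

/-! ### A separable parametrisation of the scores on a sample -/

lemma norm_sq_sum_smul_of_orthogonal {n : ℕ} {e : Fin n → H}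
    (he : Pairwise fun i k => (inner ℝ (e i) (e k) : ℝ) = 0) (u : Fin n → ℝ) :
    ‖∑ i, u i • e i‖ ^ 2 = ∑ i, u i ^ 2 * ‖e i‖ ^ 2 := by
  rw [← real_inner_self_eq_norm_sq, sum_inner]
  refine Finset.sum_congr rfl fun i _ => ?_
  rw [inner_sum, Finset.sum_eq_single i]
  · rw [real_inner_smul_left, real_inner_smul_right, real_inner_self_eq_norm_sq]
    ring
  · intro k _ hk
    rw [real_inner_smul_left, real_inner_smul_right, he hk.symm, mul_zero, mul_zero]
  · simp

lemma norm_sq_sum_smul_le {n : ℕ} {e : Fin n → H}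
    (he : Pairwise fun i k => (inner ℝ (e i) (e k) : ℝ) = 0) (he1 : ∀ i, ‖e i‖ ≤ 1)
    (u : Fin n → ℝ) : ‖∑ i, u i • e i‖ ^ 2 ≤ ∑ i, u i ^ 2 := by
  rw [norm_sq_sum_smul_of_orthogonal he]
  exact Finset.sum_le_sum fun i _ =>
    mul_le_of_le_one_right (sq_nonneg _) (pow_le_one₀ (norm_nonneg _) (he1 i))

/-- Bessel's inequality for an orthogonal family of vectors of norm at most one. -/
lemma sum_inner_sq_le {n : ℕ} {e : Fin n → H}
    (he : Pairwise fun i k => (inner ℝ (e i) (e k) : ℝ) = 0) (he1 : ∀ i, ‖e i‖ ≤ 1) (w : H) :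
    ∑ i, (inner ℝ w (e i) : ℝ) ^ 2 ≤ ‖w‖ ^ 2 := by
  have h1 := norm_sq_sum_smul_le he he1 fun i => inner ℝ w (e i)
  have h2 := norm_sub_sq_real w (∑ i, (inner ℝ w (e i) : ℝ) • e i)
  have h3 : (inner ℝ w (∑ i, (inner ℝ w (e i) : ℝ) • e i) : ℝ)
      = ∑ i, (inner ℝ w (e i) : ℝ) ^ 2 := by
    simp [inner_sum, real_inner_smul_right, sq]
  rw [h3] at h2
  nlinarith [sq_nonneg ‖w - ∑ i, (inner ℝ w (e i) : ℝ) • e i‖]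

variable (K : Submodule ℝ H) [K.HasOrthogonalProjection]

/-- Scores on a sample of size `n`, in which the component of `φ x` orthogonal to `K` is replaced by
a vector of the same norm along a fresh coordinate axis, a different one for each position `i` in
the sample. The parameter `θ` consists of weights for `φ` and of the coordinates on these axes. -/
noncomputable def augmentedScore {c n : ℕ} (φ : X → H) (θ : (Fin c → H) × (Fin n → Fin c → ℝ))
    (i : Fin n) (x : X) : EuclideanSpace ℝ (Fin c) :=
  WithLp.toLp 2 fun j => inner ℝ (θ.1 j) (φ x) + ‖Kᗮ.starProjection (φ x)‖ * θ.2 i j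

/-- The ball of radius `Λ` of parameters for `augmentedScore`. -/
def augmentedBall (c n : ℕ) (Λ : ℝ) : Set ((Fin c → H) × (Fin n → Fin c → ℝ)) :=
  {θ | (∀ j, θ.1 j ∈ K) ∧ ∑ j, (‖θ.1 j‖ ^ 2 + ∑ i, θ.2 i j ^ 2) ≤ Λ ^ 2}

omit [K.HasOrthogonalProjection] in
lemma isSeparable_augmentedBall (hK : TopologicalSpace.IsSeparable (K : Set H)) (c n : ℕ) (Λ : ℝ) :
    TopologicalSpace.IsSeparable (augmentedBall K c n Λ) :=
  ((TopologicalSpace.IsSeparable.univ_pi fun _ : Fin c => hK).prod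
    (.of_separableSpace Set.univ)).mono fun _ hθ => ⟨fun j _ => hθ.1 j, Set.mem_univ _⟩

variable {K}

lemma inner_starProjection_orthogonal (v w : H) :
    (inner ℝ (Kᗮ.starProjection v) (Kᗮ.starProjection w) : ℝ)
      = inner ℝ (Kᗮ.starProjection v) w := by
  rw [← Submodule.inner_starProjection_left_eq_right,
    Submodule.starProjection_eq_self_iff.2 (Kᗮ.starProjection_apply_mem _)]

/-- If the components of `φ (x i)` orthogonal to `K` are pairwise orthogonal, then every member of
the kernel class has augmented scores. -/
lemma exists_augmentedScore_eq {c n : ℕ} {φ : X → H} {Λ : ℝ} {x : Fin n → X}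
    (hx : Pairwise fun i k =>
      (inner ℝ (Kᗮ.starProjection (φ (x i))) (Kᗮ.starProjection (φ (x k))) : ℝ) = 0)
    {W : Fin c → H} (hW : normH2 W ≤ Λ) :
    ∃ θ ∈ augmentedBall K c n Λ, (∀ j, W j - θ.1 j ∈ Kᗮ) ∧
      ∀ i, augmentedScore K φ θ i (x i) = linearScore φ W (x i) := by
  set e : Fin n → H := fun i =>
    ‖Kᗮ.starProjection (φ (x i))‖⁻¹ • Kᗮ.starProjection (φ (x i)) with he
  have he0 : Pairwise fun i k => (inner ℝ (e i) (e k) : ℝ) = 0 := fun i k hik => by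
    simp only [he, real_inner_smul_left, real_inner_smul_right, hx hik, mul_zero]
  have he1 (i) : ‖e i‖ ≤ 1 := by
    rw [he, norm_smul, norm_inv, norm_norm]
    exact inv_mul_le_one
  have hadd (j : Fin c) : K.starProjection (W j) + Kᗮ.starProjection (W j) = W j :=
    (Submodule.starProjection_add_starProjection_orthogonal (W j))
  refine ⟨(fun j => K.starProjection (W j), fun i j => inner ℝ (Kᗮ.starProjection (W j)) (e i)),
    ⟨fun j => K.starProjection_apply_mem _, ?_⟩, fun j => ?_, fun i => ?_⟩
  · refine (Finset.sum_le_sum fun j _ => ?_).trans (sum_norm_sq_le_of_normH2_le hW)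
    rw [Submodule.norm_sq_eq_add_norm_sq_starProjection (W j) K]
    exact add_le_add_right (sum_inner_sq_le he0 he1 _) _
  · rw [← eq_sub_of_add_eq' (hadd j)]
    exact Kᗮ.starProjection_apply_mem _
  · ext j
    simp only [augmentedScore, linearScore, he, real_inner_smul_right]
    rw [inner_starProjection_orthogonal]
    nth_rw 3 [← hadd j]
    rw [inner_add_left, add_right_inj]
    by_cases h : ‖Kᗮ.starProjection (φ (x i))‖ = 0
    · rw [h, zero_mul, ← inner_starProjection_orthogonal, norm_eq_zero.1 h, inner_zero_right]
    · rw [mul_inv_cancel_left₀ h]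

/-- Augmented scores are scores of a member of the kernel class, which may moreover be chosen to
have prescribed values on a second sample. -/
lemma exists_linearScore_eq {c n m : ℕ} {φ : X → H} {Λ : ℝ} (hΛ : 0 ≤ Λ) {x : Fin n → X}
    {x' : Fin m → X} (hx : Pairwise fun i k =>
      (inner ℝ (Kᗮ.starProjection (φ (x i))) (Kᗮ.starProjection (φ (x k))) : ℝ) = 0)
    (hx' : ∀ i k,
      (inner ℝ (Kᗮ.starProjection (φ (x i))) (Kᗮ.starProjection (φ (x' k))) : ℝ) = 0)
    {θ : (Fin c → H) × (Fin n → Fin c → ℝ)} (hθ : θ ∈ augmentedBall K c n Λ) :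
    ∃ W : Fin c → H, normH2 W ≤ Λ ∧
      (∀ i, linearScore φ W (x i) = augmentedScore K φ θ i (x i)) ∧
      ∀ k, linearScore φ W (x' k) = linearScore φ θ.1 (x' k) := by
  set e : Fin n → H := fun i =>
    ‖Kᗮ.starProjection (φ (x i))‖⁻¹ • Kᗮ.starProjection (φ (x i)) with he
  have he0 : Pairwise fun i k => (inner ℝ (e i) (e k) : ℝ) = 0 := fun i k hik => by
    simp only [he, real_inner_smul_left, real_inner_smul_right, hx hik, mul_zero]
  have he1 (i) : ‖e i‖ ≤ 1 := by
    rw [he, norm_smul, norm_inv, norm_norm]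
    exact inv_mul_le_one
  have heK (i) : e i ∈ Kᗮ := Submodule.smul_mem _ _ (Kᗮ.starProjection_apply_mem _)
  have heφ (i y) : (inner ℝ (e i) (φ y) : ℝ) = ‖Kᗮ.starProjection (φ (x i))‖⁻¹
      * inner ℝ (Kᗮ.starProjection (φ (x i))) (Kᗮ.starProjection (φ y)) := by
    rw [inner_starProjection_orthogonal, he, real_inner_smul_left]
  refine ⟨fun j => θ.1 j + ∑ i, θ.2 i j • e i, normH2_le_of_sum_norm_sq_le hΛ ?_,
    fun k => ?_, fun k => ?_⟩
  · refine (Finset.sum_le_sum fun j _ => ?_).trans hθ.2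
    have horth : (inner ℝ (θ.1 j) (∑ i, θ.2 i j • e i) : ℝ) = 0 :=
      Submodule.inner_right_of_mem_orthogonal (hθ.1 j)
        (Submodule.sum_mem _ fun i _ => Submodule.smul_mem _ _ (heK i))
    rw [norm_add_sq_real, horth, mul_zero, add_zero]
    exact add_le_add_right (norm_sq_sum_smul_le he0 he1 _) _
  · ext j
    simp only [augmentedScore, linearScore, inner_add_left, sum_inner, real_inner_smul_left, heφ]
    rw [Finset.sum_eq_single k (fun i _ hi => by rw [hx hi]; simp) (by simp),
      real_inner_self_eq_norm_sq]
    by_cases h : ‖Kᗮ.starProjection (φ (x k))‖ = 0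
    · rw [h]
      simp
    · field_simp
  · ext j
    simp only [linearScore, inner_add_left, sum_inner, real_inner_smul_left, heφ, hx', mul_zero,
      Finset.sum_const_zero, add_zero]

end Augmented

section Symmetrisation

open scoped BigOperators

variable {Z : Type*} [MeasurableSpace Z]

/-! ### Symmetrisation and the tail bound -/

/-- For functions that need not be measurable, `∫⁻` is a lower integral, hence superadditive. -/
lemma sum_lintegral_le {ι : Type*} (u : Finset ι) (P : Measure Z) (f : ι → Z → ENNReal) :
    ∑ i ∈ u, ∫⁻ z, f i z ∂P ≤ ∫⁻ z, ∑ i ∈ u, f i z ∂P := by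
  classical
  induction u using Finset.induction_on with
  | empty => simp
  | insert a u ha ih =>
    simp only [Finset.sum_insert ha]
    exact (add_le_add_right ih _).trans (le_lintegral_add _ _)

/-- Exchanging the two entries of those pairs whose sign is `-1`. -/
def swapPairs {n : ℕ} (σ : Fin n → ℤˣ) : (Fin n → Z × Z) ≃ᵐ (Fin n → Z × Z) :=
  MeasurableEquiv.piCongrRight fun i =>
    if σ i = 1 then MeasurableEquiv.refl (Z × Z) else MeasurableEquiv.prodComm

lemma swapPairs_sub {n : ℕ} (σ : Fin n → ℤˣ) (p : Fin n → Z × Z) (i : Fin n) (f : Z → ℝ) :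
    f (swapPairs σ p i).2 - f (swapPairs σ p i).1
      = ((σ i : ℤ) : ℝ) * (f (p i).2 - f (p i).1) := by
  have h : swapPairs σ p i = (if σ i = 1 then MeasurableEquiv.refl (Z × Z)
    else MeasurableEquiv.prodComm) (p i) := rfl
  rcases Int.units_eq_one_or (σ i) with hi | hi
  · simp [h, hi]
  · have : (-1 : ℤˣ) ≠ 1 := by decide
    simp [h, hi, this, MeasurableEquiv.prodComm]

lemma measurePreserving_swapPairs {n : ℕ} (D : Measure Z) [IsProbabilityMeasure D]
    (σ : Fin n → ℤˣ) :
    MeasurePreserving (swapPairs (Z := Z) σ) (Measure.pi fun _ => D.prod D)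
      (Measure.pi fun _ => D.prod D) := by
  have h (i : Fin n) : MeasurePreserving (if σ i = 1 then MeasurableEquiv.refl (Z × Z)
      else MeasurableEquiv.prodComm : Z × Z ≃ᵐ Z × Z) (D.prod D) (D.prod D) := by
    split_ifs
    · exact MeasurePreserving.id _
    · exact Measure.measurePreserving_swap
  exact measurePreserving_pi (fun _ : Fin n => D.prod D) (fun _ => D.prod D) h

/-- Integrals over pairs of samples are bounded by the average over all exchanges of entries,
for an integrand that need not be measurable. -/
lemma lintegral_le_of_sum_swapPairs_le {n : ℕ} (D : Measure Z) [IsProbabilityMeasure D]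
    {T : (Fin n → Z × Z) → ENNReal} {a : ENNReal}
    (hT : ∀ p, ∑ σ : Fin n → ℤˣ, T (swapPairs σ p) ≤ Fintype.card (Fin n → ℤˣ) * a) :
    ∫⁻ p, T p ∂(Measure.pi fun _ => D.prod D) ≤ a := by
  set Q := Measure.pi fun _ : Fin n => D.prod D
  have h1 : (Fintype.card (Fin n → ℤˣ) : ENNReal) * ∫⁻ p, T p ∂Q
      ≤ Fintype.card (Fin n → ℤˣ) * a := by
    calc (Fintype.card (Fin n → ℤˣ) : ENNReal) * ∫⁻ p, T p ∂Q
        = ∑ σ : Fin n → ℤˣ, ∫⁻ p, T (swapPairs σ p) ∂Q := by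
          simp [(measurePreserving_swapPairs D _).lintegral_comp_emb
            (MeasurableEquiv.measurableEmbedding _) T, Q]
      _ ≤ ∫⁻ p, ∑ σ : Fin n → ℤˣ, T (swapPairs σ p) ∂Q := sum_lintegral_le _ _ _
      _ ≤ ∫⁻ _p, Fintype.card (Fin n → ℤˣ) * a ∂Q := lintegral_mono hT
      _ = _ := by simp
  exact (ENNReal.mul_le_mul_iff_right (by simp) (by simp)).1 h1

/-- Jensen's inequality for the exponential, in terms of `∫⁻`. -/
lemma ofReal_exp_integral_le {P : Measure Z} [IsProbabilityMeasure P] {f : Z → ℝ} {C : ℝ}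
    (hf : Measurable f) (hfC : ∀ z, |f z| ≤ C) :
    ENNReal.ofReal (Real.exp (∫ z, f z ∂P)) ≤ ∫⁻ z, ENNReal.ofReal (Real.exp (f z)) ∂P := by
  have hint : Integrable f P :=
    Integrable.of_bound hf.aestronglyMeasurable C (Filter.Eventually.of_forall hfC)
  have hexp : Integrable (fun z => Real.exp (f z)) P :=
    Integrable.of_bound hf.exp.aestronglyMeasurable (Real.exp C)
      (Filter.Eventually.of_forall fun z => by
        rw [Real.norm_eq_abs, Real.abs_exp]
        exact Real.exp_le_exp.2 ((le_abs_self _).trans (hfC z)))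
  rw [← ofReal_integral_eq_lintegral_ofReal hexp
    (Filter.Eventually.of_forall fun _ => (Real.exp_pos _).le)]
  exact ENNReal.ofReal_le_ofReal (convexOn_exp.map_integral_le Real.continuous_exp.continuousOn
    isClosed_univ (Filter.Eventually.of_forall fun _ => Set.mem_univ _) hint hexp)

lemma integral_pi_average {n : ℕ} (hn : 0 < n) (D : Measure Z) [IsProbabilityMeasure D]
    {f : Z → ℝ} (hf : Integrable f D) :
    ∫ S, 1 / (n : ℝ) * ∑ i, f (S i) ∂(Measure.pi fun _ : Fin n => D) = ∫ z, f z ∂D := by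
  have hn' : (n : ℝ) ≠ 0 := by positivity
  rw [integral_const_mul, integral_finsetSum _ fun i _ => integrable_comp_eval hf]
  simp only [integral_comp_eval (μ := fun _ : Fin n => D) hf.aestronglyMeasurable]
  simp
  field_simp

/-- Tail bound for a uniform deviation over a countable family `Θ`, by symmetrisation with a second
sample. The functions of the countable family are only assumed to agree, on almost every pair of
samples, with members of a class `W` whose signed sums have controlled exponential
moments; nothing in the class `W` has to be measurable. -/
lemma measure_deviation_le {n : ℕ} (hn : 0 < n) (D : Measure Z) [IsProbabilityMeasure D]
    {Θ W : Type*} [Countable Θ] {M s E t : ℝ} (hs : 0 ≤ s)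
    {k : Θ → Z → ℝ} (hkm : ∀ θ, Measurable (k θ)) (hk : ∀ θ z, |k θ z| ≤ M)
    {q : Θ → (Fin n → Z) → ℝ} (hqm : ∀ θ, Measurable (q θ))
    {l : W → Z → ℝ} (hl : ∀ w z z', |l w z - l w z'| ≤ M)
    (hkl : ∀ᵐ SS ∂((Measure.pi fun _ : Fin n => D).prod (Measure.pi fun _ : Fin n => D)),
      ∀ θ, ∃ w, q θ SS.1 = 1 / (n : ℝ) * ∑ i, l w (SS.1 i) ∧ ∀ i, k θ (SS.2 i) = l w (SS.2 i))
    (hE : ∀ p : Fin n → Z × Z, 𝔼 σ : Fin n → ℤˣ, Real.exp (s * ⨆ w,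
      1 / (n : ℝ) * ∑ i, ((σ i : ℤ) : ℝ) * (l w (p i).2 - l w (p i).1)) ≤ Real.exp E) :
    (Measure.pi fun _ : Fin n => D) {S | ∃ θ, t < ∫ z, k θ z ∂D - q θ S}
      ≤ ENNReal.ofReal (Real.exp (E - s * t)) := by
  set P := Measure.pi fun _ : Fin n => D with hP
  set B : Set (Fin n → Z) := {S | ∃ θ, t < ∫ z, k θ z ∂D - q θ S} with hB
  have hn' : (0 : ℝ) < n := Nat.cast_pos.2 hn
  have havg (θ : Θ) : Measurable fun S : Fin n → Z => 1 / (n : ℝ) * ∑ i, k θ (S i) :=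
    (Finset.measurable_sum _ fun i _ => (hkm θ).comp (measurable_pi_apply i)).const_mul _
  have havgM (θ : Θ) (S : Fin n → Z) : |1 / (n : ℝ) * ∑ i, k θ (S i)| ≤ M := by
    rw [abs_mul, abs_of_pos (by positivity : 0 < 1 / (n : ℝ))]
    calc 1 / (n : ℝ) * |∑ i, k θ (S i)| ≤ 1 / (n : ℝ) * ∑ _i : Fin n, M :=
          mul_le_mul_of_nonneg_left ((Finset.abs_sum_le_sum_abs _ _).trans
            (Finset.sum_le_sum fun i _ => hk θ _)) (by positivity)
      _ = M := by
          simp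
          field_simp
  set T₀ : (Fin n → Z) × (Fin n → Z) → ENNReal := fun SS =>
    ⨆ θ, ENNReal.ofReal (Real.exp (s * (1 / (n : ℝ) * ∑ i, k θ (SS.2 i) - q θ SS.1))) with hT₀
  set T : (Fin n → Z × Z) → ENNReal := fun p =>
    ⨆ w, ENNReal.ofReal (Real.exp (s * (1 / (n : ℝ) * ∑ i, (l w (p i).2 - l w (p i).1)))) with hT
  have hT₀m : Measurable T₀ := Measurable.iSup fun θ => ENNReal.measurable_ofReal.comp
    ((((havg θ).comp measurable_snd).sub ((hqm θ).comp measurable_fst)).const_mul s).exp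
  have hBm : MeasurableSet B := by
    have : B = ⋃ θ, {S | t < ∫ z, k θ z ∂D - q θ S} := by
      ext S
      simp [hB]
    rw [this]
    exact MeasurableSet.iUnion fun θ =>
      measurableSet_lt measurable_const ((hqm θ).const_sub _)
  have hpoint : ∀ S ∈ B, ENNReal.ofReal (Real.exp (s * t)) ≤ ∫⁻ S', T₀ (S, S') ∂P := by
    rintro S ⟨θ, hθ⟩
    have hint : ∫ S', s * (1 / (n : ℝ) * ∑ i, k θ (S' i) - q θ S) ∂P
        = s * (∫ z, k θ z ∂D - q θ S) := by
      have hk' : Integrable (k θ) D := Integrable.of_bound (hkm θ).aestronglyMeasurable M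
        (Filter.Eventually.of_forall (hk θ))
      rw [integral_const_mul, integral_sub (Integrable.of_bound (havg θ).aestronglyMeasurable M
        (Filter.Eventually.of_forall (havgM θ))) (integrable_const _), integral_pi_average hn D hk']
      simp
    calc ENNReal.ofReal (Real.exp (s * t))
        ≤ ENNReal.ofReal (Real.exp (s * (∫ z, k θ z ∂D - q θ S))) :=
          ENNReal.ofReal_le_ofReal (Real.exp_le_exp.2 (mul_le_mul_of_nonneg_left hθ.le hs))
      _ ≤ ∫⁻ S', ENNReal.ofReal
            (Real.exp (s * (1 / (n : ℝ) * ∑ i, k θ (S' i) - q θ S))) ∂P := by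
          rw [← hint]
          refine ofReal_exp_integral_le (C := s * (M + |q θ S|))
            (((havg θ).sub_const _).const_mul _) fun S' => ?_
          rw [abs_mul, abs_of_nonneg hs]
          exact mul_le_mul_of_nonneg_left ((abs_sub _ _).trans
            (add_le_add_left (havgM θ S') _)) hs
      _ ≤ _ := lintegral_mono fun S' => le_iSup (fun θ => ENNReal.ofReal
            (Real.exp (s * (1 / (n : ℝ) * ∑ i, k θ (S' i) - q θ S)))) θ
  have hswap (p : Fin n → Z × Z) : ∑ σ : Fin n → ℤˣ, T (swapPairs σ p)
      ≤ Fintype.card (Fin n → ℤˣ) * ENNReal.ofReal (Real.exp E) := by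
    have hle (σ : Fin n → ℤˣ) : T (swapPairs σ p) ≤ ENNReal.ofReal (Real.exp (s * ⨆ w,
        1 / (n : ℝ) * ∑ i, ((σ i : ℤ) : ℝ) * (l w (p i).2 - l w (p i).1))) := by
      refine iSup_le fun w => ENNReal.ofReal_le_ofReal (Real.exp_le_exp.2
        (mul_le_mul_of_nonneg_left ?_ hs))
      simp only [swapPairs_sub σ p _ (l w)]
      refine le_ciSup (f := fun w => 1 / (n : ℝ) * ∑ i, ((σ i : ℤ) : ℝ)
        * (l w (p i).2 - l w (p i).1)) (bddAbove_range_of_abs_le (C := 1 / (n : ℝ) * (n * M))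
        fun w => ?_) w
      rw [abs_mul, abs_of_pos (by positivity : 0 < 1 / (n : ℝ))]
      exact mul_le_mul_of_nonneg_left (abs_signed_sum_le σ fun i => hl w _ _) (by positivity)
    refine (Finset.sum_le_sum fun σ _ => hle σ).trans ?_
    rw [← ENNReal.ofReal_sum_of_nonneg fun _ _ => (Real.exp_pos _).le,
      ← Fintype.card_mul_expect, ENNReal.ofReal_mul (Nat.cast_nonneg _), ENNReal.ofReal_natCast]
    gcongr
    exact hE p
  have hmain : ENNReal.ofReal (Real.exp (s * t)) * P B ≤ ENNReal.ofReal (Real.exp E) := by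
    have hmp := measurePreserving_arrowProdEquivProdArrow Z Z (Fin n) (fun _ => D) fun _ => D
    calc ENNReal.ofReal (Real.exp (s * t)) * P B
        = ∫⁻ _S in B, ENNReal.ofReal (Real.exp (s * t)) ∂P := by simp
      _ ≤ ∫⁻ S in B, ∫⁻ S', T₀ (S, S') ∂P ∂P := setLIntegral_mono' hBm hpoint
      _ ≤ ∫⁻ S, ∫⁻ S', T₀ (S, S') ∂P ∂P := setLIntegral_le_lintegral _ _
      _ = ∫⁻ SS, T₀ SS ∂(P.prod P) := (lintegral_prod _ hT₀m.aemeasurable).symm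
      _ = ∫⁻ p, T₀ (MeasurableEquiv.arrowProdEquivProdArrow Z Z (Fin n) p)
            ∂(Measure.pi fun _ => D.prod D) := (hmp.lintegral_comp hT₀m).symm
      _ ≤ ∫⁻ p, T p ∂(Measure.pi fun _ => D.prod D) := by
          refine lintegral_mono_ae ?_
          filter_upwards [hmp.quasiMeasurePreserving.ae hkl] with p hp
          refine iSup_le fun θ => ?_
          obtain ⟨w, hq, hk⟩ := hp θ
          refine le_trans (le_of_eq ?_) (le_iSup _ w)
          rw [hq, Finset.sum_sub_distrib, mul_sub (1 / (n : ℝ)),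
            Finset.sum_congr rfl fun i _ => hk i]
          rfl
      _ ≤ _ := lintegral_le_of_sum_swapPairs_le D hswap
  rw [Real.exp_sub, ENNReal.ofReal_div_of_pos (Real.exp_pos _)]
  rw [ENNReal.le_div_iff_mul_le (by simp [Real.exp_pos]) (by simp), mul_comm]
  exact hmain

lemma ae_pi_pairwise {n : ℕ} (D : Measure Z) [IsProbabilityMeasure D] {p : Z → Z → Prop}
    (hpm : MeasurableSet {z : Z × Z | p z.1 z.2}) (hp : ∀ z, ∀ᵐ z' ∂D, p z z') :
    ∀ᵐ S ∂(Measure.pi fun _ : Fin n => D), Pairwise fun i k => p (S i) (S k) := by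
  have hpp : ∀ᵐ z ∂(D.prod D), p z.1 z.2 :=
    (Measure.ae_prod_iff_ae_ae hpm).2 (Filter.Eventually.of_forall hp)
  simp only [Pairwise]
  refine ae_all_iff.2 fun i => ae_all_iff.2 fun k => ?_
  by_cases hik : i = k
  · exact Filter.Eventually.of_forall fun _ h => absurd hik h
  have hind := (ProbabilityTheory.iIndepFun_pi (μ := fun _ : Fin n => D)
    (X := fun _ => (id : Z → Z)) fun _ => aemeasurable_id).indepFun hik
  have hmap := (ProbabilityTheory.indepFun_iff_map_prod_eq_prod_map_map
    (measurable_pi_apply i).aemeasurable (measurable_pi_apply k).aemeasurable).1 hind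
  have hi (i : Fin n) : (Measure.pi fun _ : Fin n => D).map (fun S => S i) = D :=
    (measurePreserving_eval (fun _ : Fin n => D) i).map_eq
  rw [hi, hi] at hmap
  rw [← hmap] at hpp
  filter_upwards [ae_of_ae_map
    ((measurable_pi_apply i).prodMk (measurable_pi_apply k)).aemeasurable hpp] with S hS _
  exact hS

lemma ae_pi_prod_pi {n : ℕ} (D : Measure Z) [IsProbabilityMeasure D] {p : Z → Z → Prop}
    (hpm : MeasurableSet {z : Z × Z | p z.1 z.2}) (hp : ∀ z, ∀ᵐ z' ∂D, p z z') :
    ∀ᵐ SS ∂((Measure.pi fun _ : Fin n => D).prod (Measure.pi fun _ : Fin n => D)),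
      ∀ i k, p (SS.1 i) (SS.2 k) := by
  have hpp : ∀ᵐ z ∂(D.prod D), p z.1 z.2 :=
    (Measure.ae_prod_iff_ae_ae hpm).2 (Filter.Eventually.of_forall hp)
  refine ae_all_iff.2 fun i => ae_all_iff.2 fun k => ?_
  exact ((measurePreserving_eval (fun _ : Fin n => D) i).prod
    (measurePreserving_eval (fun _ : Fin n => D) k)).quasiMeasurePreserving.ae hpp

end Symmetrisation

section Generalisation

open scoped BigOperators

variable {X H : Type*} [MeasurableSpace X] [NormedAddCommGroup H] [InnerProductSpace ℝ H]

/-! ### The uniform deviation of the kernel class -/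

lemma measurable_loss {Y : Type*} [MeasurableSpace Y] {c : ℕ}
    {L : EuclideanSpace ℝ (Fin c) → Label c → ℝ} {μ : ℝ≥0}
    (hLip : ∀ y, LipschitzWith μ fun u => L u y) {f : Y → EuclideanSpace ℝ (Fin c)}
    {g : Y → Label c} (hf : Measurable f) (hg : Measurable g) : Measurable fun z => L (f z) (g z) := by
  have h : Measurable fun p : EuclideanSpace ℝ (Fin c) × Label c => L p.1 p.2 :=
    measurable_from_prod_countable_left fun y => (hLip y).continuous.measurable
  exact h.comp (hf.prodMk hg)

lemma measurable_linearScore {c : ℕ} {φ : X → H}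
    (hφm : ∀ w, Measurable fun x => (inner ℝ w (φ x) : ℝ)) (W : Fin c → H) :
    Measurable (linearScore φ W) :=
  (WithLp.measurable_toLp 2 _).comp (measurable_pi_iff.2 fun j => hφm (W j))

lemma measurable_augmentedScore {c n : ℕ} {φ : X → H}
    (hφm : ∀ w, Measurable fun x => (inner ℝ w (φ x) : ℝ)) {K : Submodule ℝ H}
    [K.HasOrthogonalProjection]
    (hKm : Measurable fun x => ‖Kᗮ.starProjection (φ x)‖)
    (θ : (Fin c → H) × (Fin n → Fin c → ℝ)) (i : Fin n) :
    Measurable (augmentedScore K φ θ i) :=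
  (WithLp.measurable_toLp 2 _).comp (measurable_pi_iff.2 fun j =>
    (hφm (θ.1 j)).add (hKm.mul_const (θ.2 i j)))

omit [MeasurableSpace X] in
lemma continuous_linearScore {c : ℕ} (φ : X → H) (x : X) :
    Continuous fun W : Fin c → H => linearScore φ W x :=
  (PiLp.continuous_toLp 2 _).comp (continuous_pi fun j =>
    (continuous_apply j).inner continuous_const)

omit [MeasurableSpace X] in
lemma continuous_augmentedScore {c n : ℕ} (φ : X → H) (K : Submodule ℝ H)
    [K.HasOrthogonalProjection] (i : Fin n) (x : X) :
    Continuous fun θ : (Fin c → H) × (Fin n → Fin c → ℝ) => augmentedScore K φ θ i x := by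
  refine (PiLp.continuous_toLp 2 _).comp (continuous_pi fun j => ?_)
  exact (((continuous_apply j).comp continuous_fst).inner continuous_const).add
    (continuous_const.mul ((continuous_apply j).comp ((continuous_apply i).comp continuous_snd)))

/-- The tail bound for the uniform deviation over the kernel class, on a measurable event. -/
lemma exists_measurableSet_deviation_le [CompleteSpace H] {c n : ℕ} (hn : 0 < n)
    (D : Measure (X × Label c)) [IsProbabilityMeasure D]
    {κ : X → X → ℝ} (hκm : Measurable fun p : X × X => κ p.1 p.2) {φ : X → H}
    (hφ : IsFeatureMap κ φ) {Λ r M : ℝ} (hφr : ∀ x, ‖φ x‖ ≤ r) (hΛ : 0 ≤ Λ)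
    {L : EuclideanSpace ℝ (Fin c) → Label c → ℝ} {μ : ℝ≥0}
    (hL0 : ∀ u y, 0 ≤ L u y) (hLM : ∀ u y, L u y ≤ M) (hLip : ∀ y, LipschitzWith μ fun u => L u y)
    {s t : ℝ} (hs : 0 ≤ s) :
    ∃ A : Set (Fin n → X × Label c), MeasurableSet A ∧
      1 - Real.exp (s * (2 * √2 * μ * √(c * Λ ^ 2 * r ^ 2 / n)) + s ^ 2 * M ^ 2 / (2 * n) - s * t)
        ≤ (Measure.pi fun _ : Fin n => D).real A ∧
      ∀ S ∈ A, ∀ f ∈ kernelClass c φ Λ, risk D L f ≤ empiricalRisk L S f + t := by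
  have hφm := measurable_inner_featureMap hκm hφ
  have : IsProbabilityMeasure (D.map Prod.fst) :=
    Measure.isProbabilityMeasure_map measurable_fst.aemeasurable
  obtain ⟨K, _, hKs, hK0⟩ := exists_separable_submodule (D.map Prod.fst) hφm hφr
  have hK0' (w) (hw : w ∈ Kᗮ) : ∀ᵐ z ∂D, (inner ℝ w (φ z.1) : ℝ) = 0 :=
    ae_of_ae_map measurable_fst.aemeasurable (hK0 w hw)
  have hκ₂ := measurable_inner_orthogonal_starProjection hκm hφ hφm K hKs
  have hKm : Measurable fun x => ‖Kᗮ.starProjection (φ x)‖ := by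
    have h1 : (fun x => ‖Kᗮ.starProjection (φ x)‖)
        = fun x => √(inner ℝ (Kᗮ.starProjection (φ x)) (Kᗮ.starProjection (φ x))) := by
      funext x
      rw [real_inner_self_eq_norm_sq, Real.sqrt_sq (norm_nonneg _)]
    rw [h1]
    exact (hκ₂.comp (measurable_id.prodMk measurable_id)).sqrt
  have hLabs (u y) : |L u y| ≤ M := by rw [abs_of_nonneg (hL0 _ _)]; exact hLM _ _
  -- On almost every sample, the components of the features orthogonal to `K` are pairwise
  -- orthogonal.
  set orth : X × Label c → X × Label c → Prop := fun z z' =>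
    (inner ℝ (Kᗮ.starProjection (φ z.1)) (Kᗮ.starProjection (φ z'.1)) : ℝ) = 0 with horth
  have horthm : MeasurableSet {z : (X × Label c) × (X × Label c) | orth z.1 z.2} :=
    (hκ₂.comp ((measurable_fst.comp measurable_fst).prodMk
      (measurable_fst.comp measurable_snd))) (measurableSet_singleton 0)
  have horth0 (z) : ∀ᵐ z' ∂D, orth z z' := by
    simp only [horth, inner_starProjection_orthogonal]
    exact hK0' _ (Kᗮ.starProjection_apply_mem _)
  have hpair := ae_pi_pairwise (n := n) D horthm horth0
  have hpairm : MeasurableSet {S : Fin n → X × Label c |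
      Pairwise fun i k => orth (S i) (S k)} := by
    simp only [Pairwise, Set.ofPred_forall]
    have hik (i k : Fin n) : MeasurableSet ((fun S : Fin n → X × Label c => (S i, S k)) ⁻¹'
        {z | orth z.1 z.2}) :=
      ((measurable_pi_apply i).prodMk (measurable_pi_apply k)) horthm
    exact MeasurableSet.iInter fun i => MeasurableSet.iInter fun k => MeasurableSet.iInter fun _ =>
      hik i k
  have hne : Nonempty {W : Fin c → H // normH2 W ≤ Λ} := ⟨0, by simpa [normH2] using hΛ⟩
  obtain ⟨Θ, hΘ, hΘc, hΘd⟩ := (isSeparable_augmentedBall K hKs c n Λ).exists_countable_dense_subset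
  have : Countable Θ := hΘc.to_subtype
  -- The population and empirical losses of the augmented parameters.
  set k : (Fin c → H) × (Fin n → Fin c → ℝ) → X × Label c → ℝ := fun θ z =>
    L (linearScore φ θ.1 z.1) z.2 with hk
  set q : (Fin c → H) × (Fin n → Fin c → ℝ) → (Fin n → X × Label c) → ℝ := fun θ S =>
    1 / (n : ℝ) * ∑ i, L (augmentedScore K φ θ i (S i).1) (S i).2 with hq
  have hkm (θ) : Measurable (k θ) :=
    measurable_loss hLip ((measurable_linearScore hφm _).comp measurable_fst) measurable_snd
  have hqm (θ) : Measurable (q θ) :=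
    (Finset.measurable_sum _ fun i _ => measurable_loss hLip
      ((measurable_augmentedScore hφm hKm θ i).comp (measurable_fst.comp (measurable_pi_apply i)))
      (measurable_snd.comp (measurable_pi_apply i))).const_mul _
  set P := Measure.pi fun _ : Fin n => D with hP
  set B : Set (Fin n → X × Label c) := {S | ∃ θ : Θ, t < ∫ z, k θ z ∂D - q θ S} with hB
  have hBm : MeasurableSet B := by
    have : B = ⋃ θ : Θ, {S | t < ∫ z, k θ z ∂D - q θ S} := by
      ext S
      simp [hB]
    rw [this]
    exact MeasurableSet.iUnion fun θ => measurableSet_lt measurable_const ((hqm θ).const_sub _)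
  have hPB := measure_deviation_le (Θ := Θ) (W := {W : Fin c → H // normH2 W ≤ Λ}) (t := t) hn D hs
    (k := fun θ => k θ) (fun θ => hkm θ) (fun θ z => hLabs _ _) (q := fun θ => q θ) (fun θ => hqm θ)
    (l := fun W z => L (linearScore φ W.1 z.1) z.2)
    (fun W z z' => abs_sub_le_of_nonneg_of_le (hL0 _ _) (hLM _ _) (hL0 _ _) (hLM _ _)) (by
      have hfst : ∀ᵐ SS ∂(P.prod P), Pairwise fun i k => orth (SS.1 i) (SS.1 k) :=
        Measure.quasiMeasurePreserving_fst.ae hpair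
      filter_upwards [hfst, ae_pi_prod_pi (n := n) D horthm horth0] with SS h1 h2 θ
      obtain ⟨W, hW, hWS, hWS'⟩ := exists_linearScore_eq hΛ (x := fun i => (SS.1 i).1)
        (x' := fun i => (SS.2 i).1) h1 h2 (hΘ θ.2)
      exact ⟨⟨W, hW⟩, by simp only [hq, hWS], fun i => by simp only [hk, hWS']⟩)
    (fun p => expect_exp_iSup_symmetrised_le hn hΛ hs hφr hL0 hLM hLip
      (fun i => (p i).1) fun i => (p i).2)
  refine ⟨Bᶜ ∩ {S | Pairwise fun i k => orth (S i) (S k)}, hBm.compl.inter hpairm, ?_, ?_⟩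
  · have h1 : P.real (Bᶜ ∩ {S | Pairwise fun i k => orth (S i) (S k)}) = P.real Bᶜ :=
      measureReal_congr (inter_ae_eq_left_of_ae_eq_univ (Filter.eventuallyEq_univ.2 hpair))
    rw [h1, probReal_compl_eq_one_sub hBm]
    exact sub_le_sub_left (ENNReal.toReal_le_of_le_ofReal (Real.exp_pos _).le hPB) _
  · rintro S ⟨hSB, hS⟩ _ ⟨W, hW, rfl⟩
    obtain ⟨θ, hθ, hWθ, hθS⟩ := exists_augmentedScore_eq (x := fun i => (S i).1) hS hW
    have hcont : Continuous fun θ => ∫ z, k θ z ∂D - q θ S := by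
      refine Continuous.sub ?_ ?_
      · refine continuous_of_dominated (bound := fun _ => M)
          (fun θ => (hkm θ).aestronglyMeasurable)
          (fun θ => Filter.Eventually.of_forall fun z => hLabs _ _) (integrable_const _)
          (Filter.Eventually.of_forall fun z => ?_)
        exact (hLip z.2).continuous.comp ((continuous_linearScore φ z.1).comp continuous_fst)
      · exact continuous_const.mul (continuous_finsetSum _ fun i _ =>
          (hLip (S i).2).continuous.comp (continuous_augmentedScore φ K i (S i).1))
    have hle : ∫ z, k θ z ∂D - q θ S ≤ t := by
      have hcl : closure Θ ⊆ {θ | ∫ z, k θ z ∂D - q θ S ≤ t} := by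
        refine closure_minimal (fun θ hθ => ?_) (isClosed_le hcont continuous_const)
        by_contra h
        exact hSB ⟨⟨θ, hθ⟩, not_le.1 h⟩
      exact hcl (hΘd hθ)
    have hrisk : risk D L (linearScore φ W) = ∫ z, k θ z ∂D := by
      refine integral_congr_ae ?_
      filter_upwards [ae_all_iff.2 fun j => hK0' _ (hWθ j)] with z hz
      have : linearScore φ W z.1 = linearScore φ θ.1 z.1 := by
        ext j
        have := hz j
        rw [inner_sub_left, sub_eq_zero] at this
        exact this
      simp only [hk, this]
    have hemp : empiricalRisk L S (linearScore φ W) = q θ S := by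
      simp only [hq, empiricalRisk, hθS]
    rw [hrisk, hemp]
    linarith

end Generalisation

end MultiLabel

theorem theorem1 {X : Type*} [MeasurableSpace X]
    {H : Type*} [NormedAddCommGroup H] [InnerProductSpace ℝ H] [CompleteSpace H] [RKHS ℝ H X ℝ]
    (c n : ℕ) (hn : 0 < n)
    (D : Measure (X × MultiLabel.Label c)) [IsProbabilityMeasure D]
    (κ : X → X → ℝ) (hκ : MultiLabel.IsReproducingKernel (H := H) κ)
    (hκm : Measurable fun p : X × X => κ p.1 p.2)
    (φ : X → H) (hφ : MultiLabel.IsFeatureMap κ φ)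
    (Λ r M : ℝ) (hr : 0 < r) (hκr : ∀ x, κ x x ≤ r ^ 2)
    (L : EuclideanSpace ℝ (Fin c) → MultiLabel.Label c → ℝ) (μ : ℝ≥0)
    (hL0 : ∀ u y, 0 ≤ L u y) (hLM : ∀ u y, L u y ≤ M)
    (hLip : ∀ y, LipschitzWith μ fun u => L u y) :
    (∀ f ∈ MultiLabel.kernelClass c φ Λ, Integrable (fun z => L (f z.1) z.2) D) ∧
    ∀ δ : ℝ, 0 < δ →
      ∃ A : Set (Fin n → X × MultiLabel.Label c), MeasurableSet A ∧
        1 - δ ≤ (Measure.pi fun _ : Fin n => D).real A ∧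
        ∀ S ∈ A, ∀ f ∈ MultiLabel.kernelClass c φ Λ,
          MultiLabel.risk D L f ≤ MultiLabel.empiricalRisk L S f
            + 2 * √2 * μ * √(c * Λ ^ 2 * r ^ 2 / n)
            + 3 * M * √(Real.log (2 / δ) / (2 * n)) := by
  have hφr (x : X) : ‖φ x‖ ≤ r := by
    refine abs_le_of_sq_le_sq' ?_ hr.le |>.2
    rw [← real_inner_self_eq_norm_sq, hφ]
    exact hκr x
  have hn' : (0 : ℝ) < n := Nat.cast_pos.2 hn
  refine ⟨?_, fun δ hδ => ?_⟩
  · rintro _ ⟨W, -, rfl⟩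
    refine Integrable.of_bound (MultiLabel.measurable_loss hLip
      ((MultiLabel.measurable_linearScore (MultiLabel.measurable_inner_featureMap hκm hφ) W).comp
        measurable_fst) measurable_snd).aestronglyMeasurable M
      (Filter.Eventually.of_forall fun z => ?_)
    rw [Real.norm_eq_abs, abs_of_nonneg (hL0 _ _)]
    exact hLM _ _
  rcases le_or_gt 1 δ with hδ1 | hδ1
  · exact ⟨∅, MeasurableSet.empty, by simpa using hδ1, fun S hS => absurd hS (Set.notMem_empty S)⟩
  rcases lt_or_ge Λ 0 with hΛ | hΛ
  · refine ⟨Set.univ, MeasurableSet.univ, by simp [hδ.le], ?_⟩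
    rintro S - _ ⟨W, hW, -⟩
    exact absurd ((Real.sqrt_nonneg _).trans hW) (not_le.2 hΛ)
  obtain ⟨z₀⟩ : Nonempty (X × MultiLabel.Label c) := nonempty_of_isProbabilityMeasure D
  have hM : 0 ≤ M := (hL0 0 z₀.2).trans (hLM 0 z₀.2)
  rcases hM.eq_or_lt with rfl | hM
  · -- A loss bounded by `0` vanishes identically.
    have hL (u y) : L u y = 0 := le_antisymm (hLM u y) (hL0 u y)
    refine ⟨Set.univ, MeasurableSet.univ, by simp [hδ.le], fun S _ f _ => ?_⟩
    simp only [MultiLabel.risk, MultiLabel.empiricalRisk, hL, integral_zero, Finset.sum_const_zero,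
      mul_zero, zero_add, zero_mul, add_zero]
    positivity
  have hlog : 0 < Real.log (2 / δ) := Real.log_pos (by rw [lt_div_iff₀ hδ]; linarith)
  set b := 2 * √2 * μ * √(c * Λ ^ 2 * r ^ 2 / n) with hb
  set τ := 3 * M * √(Real.log (2 / δ) / (2 * n)) with hτ
  have hτ0 : 0 ≤ τ := by positivity
  -- `s = n τ / M ^ 2` minimises the exponent `s ^ 2 * M ^ 2 / (2 * n) - s * τ`, and the minimum
  -- `-n τ ^ 2 / (2 * M ^ 2)` gives the tail `(δ / 2) ^ (9 / 4) ≤ δ / 2`.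
  obtain ⟨A, hAm, hPA, hA⟩ := MultiLabel.exists_measurableSet_deviation_le hn D hκm hφ hφr hΛ
    hL0 hLM hLip (s := n * τ / M ^ 2) (t := b + τ) (by positivity)
  refine ⟨A, hAm, le_trans (sub_le_sub_left ?_ 1) hPA, fun S hS f hf => ?_⟩
  · rw [← hb]
    have hτ2 : τ ^ 2 = 9 * M ^ 2 * (Real.log (2 / δ) / (2 * n)) := by
      rw [hτ, mul_pow, Real.sq_sqrt (by positivity)]
      ring
    have hexp : n * τ / M ^ 2 * b + (n * τ / M ^ 2) ^ 2 * M ^ 2 / (2 * n)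
        - n * τ / M ^ 2 * (b + τ) = -(9 / 4 * Real.log (2 / δ)) := by
      have h1 : n * τ / M ^ 2 * b + (n * τ / M ^ 2) ^ 2 * M ^ 2 / (2 * n)
          - n * τ / M ^ 2 * (b + τ) = -(n * τ ^ 2 / (2 * M ^ 2)) := by
        field_simp
        ring
      rw [h1, hτ2]
      field_simp
      ring
    rw [hexp]
    calc Real.exp (-(9 / 4 * Real.log (2 / δ))) ≤ Real.exp (-Real.log (2 / δ)) :=
          Real.exp_le_exp.2 (by linarith)
      _ = δ / 2 := by rw [Real.exp_neg, Real.exp_log (by positivity), inv_div]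
      _ ≤ δ := by linarith
  · linarith [hA S hS f hf]
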